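/- Notation. Let $n\ge 1$. For $s\in\mathbb R$ let $\eta_s=\operatorname{diag}(-1,1,\dots,1,\operatorname{sign}(s)s^2)$, a form on $\mathbb R^{n+1}$, and let $\mathbb X_s\subset\mathbb{RP}^n$ be the set of lines on which $\eta_s$ is negative. Then $\mathbb X_1=\mathbb H^n$, with $\operatorname{Isom}(\mathbb H^n)=\mathrm{PO}(n,1)$, and $\mathbb X_{-1}=\mathrm{AdS}^n$, with $\operatorname{Isom}(\mathrm{AdS}^n)=\mathrm{PO}(n-1,2)$: in both cases the group of classes in $\mathrm{PGL}(n+1,\mathbb R)$ of matrices that preserve $\eta_s$. Half-pipe space is $\mathrm{HP}^n=\mathbb X_0$, and $G_{\mathrm{HP}}\subset\mathrm{PGL}(n+1,\mathbb R)$ is the group of classes of matrices $\begin{pmatrix}A&0\\ v&\pm1\end{pmatrix}$ with $A\in\mathrm O(n-1,1)$ and $v^T\in\mathbb R^n$. For $t\ne0$ put $\mathfrak r_t=\operatorname{diag}(1,\dots,1,|t|^{-1})\in\mathrm{PGL}(n+1,\mathbb R)$. A $(G,X)$ structure on a smooth connected manifold (possibly with boundary) with holonomy $\rho:\pi_1\to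 G$ is given by a developing map: a smooth $\rho$-equivariant map from the universal cover to $X$ whose differential is bijective at every point, that is, a local diffeomorphism (up to the boundary). Proposition 3.3 (Regeneration). Let $M_0$ be a compact connected smooth $n$-manifold with (possibly empty) boundary and let $M\supset M_0$ be a thickening of $M_0$: a smooth $n$-manifold without boundary in which $M_0$ is smoothly embedded, such that $M\setminus M_0$ is an open collar neighborhood of $\partial M_0$. Suppose $M$ has an $(\mathrm{HP}^n,G_{\mathrm{HP}})$ structure with holonomy $\sigma_{\mathrm{HP}}:\pi_1 M\to G_{\mathrm{HP}}$. Let $X$ be either $\mathbb H^n$ or $\mathrm{AdS}^n$, and let $\rho_t:\pi_1M_0\to\operatorname{Isom}(X)$ be a family of representations, defined for small $t>0$ if $X=\mathbb H^n$ and for small $t<0$ if $X=\mathrm{AdS}^n$, which is compatible to first order at $t=0$ with $\sigma_{\mathrm{HP}}$: for every $\gamma\in\pi_1M_0$, $$\mathfrak r_t\,\rho_t(\gamma)\,\mathfrak r_t^{-1}\longrightarrow\sigma_{\mathrm{HP}}(\gamma)\quad\text{in }\mathrm{PGL}(n+1,\mathbb R)\text{ as }t\to0,$$ where on the right $\gamma$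 is viewed in $\pi_1M$ through the inclusion $M_0\subset M$. Then there are $\varepsilon>0$ and a family of $X$ structures on $M_0$, given by developing maps $D_t$ for the $t$ of the above sign with $|t|<\varepsilon$, such that the structure at time $t$ has holonomy $\rho_t$. The family is as regular in $t$ as the representations: for $0\le k\le\infty$ and $\delta\le\varepsilon$, if $t\mapsto\rho_t(\gamma)$ is $C^k$ on the times with $|t|<\delta$ for every $\gamma$, then $(t,x)\mapsto D_t(x)$ is $C^k$ there. -/

import Mathlib

open Set Filter Topology
open scoped Manifold ContDiff Matrix LinearAlgebra.Projectivization

noncomputable section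

namespace HalfPipe

/-! ### Projective space and the model geometries

The coordinates `x₁, …, xₙ` of `ℝⁿ⁺¹` are indexed by `Fin n` and `xₙ₊₁` is indexed by `Unit`, so
that `(n+1) × (n+1)` matrices are written in `n + 1` block form. -/

/-- The vector space `ℝⁿ⁺¹`. -/
abbrev Vec (n : ℕ) : Type := Fin n ⊕ Unit → ℝ

/-- Real `(n+1) × (n+1)` matrices. -/
abbrev Mat (n : ℕ) : Type := Matrix (Fin n ⊕ Unit) (Fin n ⊕ Unit) ℝ

/-- The general linear group `GL(n+1, ℝ)`. -/
abbrev GLGroup (n : ℕ) : Type := GL (Fin n ⊕ Unit) ℝ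

/-- Real projective space `ℝPⁿ`. -/
abbrev RP (n : ℕ) : Type := ℙ ℝ (Vec n)

/-- The projective general linear group `PGL(n+1, ℝ)`. It acts on `RP n`. -/
abbrev PGL (n : ℕ) : Type := Matrix.ProjGenLinGroup (Fin n ⊕ Unit) ℝ

/-- The quotient topology on `PGL(n+1, ℝ) = GL(n+1, ℝ) / center`. -/
instance (n : ℕ) : TopologicalSpace (PGL n) :=
  inferInstanceAs (TopologicalSpace
    (GLGroup n ⧸ Subgroup.center (GLGroup n)))

/-- The `n × n` matrix `diag(-1, 1, …, 1)`. -/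
def J (n : ℕ) : Matrix (Fin n) (Fin n) ℝ :=
  Matrix.diagonal fun i => if (i : ℕ) = 0 then -1 else 1

/-- The form `η_s = diag(-1, 1, …, 1, sign(s) s²)` on `ℝⁿ⁺¹`. -/
def eta (n : ℕ) (s : ℝ) : Mat n :=
  Matrix.fromBlocks (J n) 0 0 (((SignType.sign s : ℝ) * s ^ 2) • 1)

/-- The region `𝕏_s ⊆ ℝPⁿ` of lines on which `η_s` is negative: `𝕏₁ = ℍⁿ`, `𝕏₀ = HPⁿ` and
`𝕏₋₁ = AdSⁿ`. -/
def X (n : ℕ) (s : ℝ) : Set (RP n) :=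
  {P | P.rep ⬝ᵥ (eta n s *ᵥ P.rep) < 0}

/-- Membership in `𝕏_s` may be tested on any representative of the line. -/
theorem mk_mem_X {n : ℕ} {s : ℝ} {v : Vec n} (hv : v ≠ 0) :
    Projectivization.mk ℝ v hv ∈ X n s ↔ v ⬝ᵥ (eta n s *ᵥ v) < 0 := by
  obtain ⟨a, ha⟩ := Projectivization.exists_smul_eq_mk_rep ℝ v hv
  have h0 : (a : ℝ) ≠ 0 := a.ne_zero
  have h2 : (0 : ℝ) < (a : ℝ) * a := mul_self_pos.mpr h0
  have key : (Projectivization.mk ℝ v hv).rep ⬝ᵥ (eta n s *ᵥ (Projectivization.mk ℝ v hv).rep)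
      = ((a : ℝ) * a) * (v ⬝ᵥ (eta n s *ᵥ v)) := by
    rw [← ha, Units.smul_def, Matrix.mulVec_smul, smul_dotProduct, dotProduct_smul]
    simp only [smul_eq_mul]
    ring
  rw [X, mem_ofPred_eq, key]
  constructor
  · intro h
    by_contra h'
    exact absurd h (not_lt.mpr (mul_nonneg h2.le (not_lt.mp h')))
  · intro h
    exact mul_neg_of_pos_of_neg h2 h

/-- The group of invertible matrices preserving the form `η_s`. -/
def formGroup (n : ℕ) (s : ℝ) : Subgroup (GLGroup n) where
  carrier := {A | (A : Mat n)ᵀ * eta n s * (A : Mat n) = eta n s}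
  one_mem' := by simp
  mul_mem' := by
    intro A B hA hB
    simp only [mem_ofPred_eq, Matrix.GeneralLinearGroup.coe_mul, Matrix.transpose_mul] at *
    calc _ = (B : Mat n)ᵀ * ((A : Mat n)ᵀ * eta n s * (A : Mat n))
          * (B : Mat n) := by simp only [Matrix.mul_assoc]
      _ = _ := by rw [hA, hB]
  inv_mem' := by
    intro A hA
    simp only [mem_ofPred_eq] at *
    have h1 : (A : Mat n) * ((A⁻¹ : GLGroup n) : Mat n) = 1 :=
      Units.mul_inv A
    have h2 : ((A⁻¹ : GLGroup n) : Mat n)ᵀ * (A : Mat n)ᵀ = 1 := by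
      rw [← Matrix.transpose_mul, h1, Matrix.transpose_one]
    calc _ = ((A⁻¹ : GLGroup n) : Mat n)ᵀ
          * ((A : Mat n)ᵀ * eta n s * (A : Mat n))
          * ((A⁻¹ : GLGroup n) : Mat n) := by rw [hA]
      _ = (((A⁻¹ : GLGroup n) : Mat n)ᵀ * (A : Mat n)ᵀ) * eta n s
          * ((A : Mat n) * ((A⁻¹ : GLGroup n) : Mat n)) := by
        simp only [Matrix.mul_assoc]
      _ = _ := by rw [h1, h2, Matrix.one_mul, Matrix.mul_one]

/-- The isometry group of `𝕏_s` for `s ≠ 0`, as a subgroup of `PGL(n+1, ℝ)`: the image of the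
group of matrices preserving `η_s`. For `s = 1` it is `Isom(ℍⁿ) = PO(n,1)`, for `s = -1` it is
`Isom(AdSⁿ) = PO(n-1,2)`. -/
def isom (n : ℕ) (s : ℝ) : Subgroup (PGL n) :=
  (formGroup n s).map Matrix.ProjGenLinGroup.mk

theorem J_mul_J (n : ℕ) : J n * J n = 1 := by
  rw [J, Matrix.diagonal_mul_diagonal, ← Matrix.diagonal_one]
  congr 1
  funext i
  split_ifs <;> norm_num

/-- The group of matrices of the block form `(A, 0; v, ±1)` with `A ∈ O(n-1,1)`. -/
def halfPipeMatrices (n : ℕ) : Subgroup (GLGroup n) where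
  carrier := {g | ∃ (A : Matrix (Fin n) (Fin n) ℝ) (v : Matrix Unit (Fin n) ℝ) (a : ℝ),
    Aᵀ * J n * A = J n ∧ (a = 1 ∨ a = -1) ∧
      (g : Mat n) = Matrix.fromBlocks A 0 v (a • 1)}
  one_mem' := ⟨1, 0, 1, by simp, Or.inl rfl, by simp⟩
  mul_mem' := by
    rintro g h ⟨A, v, a, hA, ha, hg⟩ ⟨B, w, b, hB, hb, hh⟩
    refine ⟨A * B, v * B + a • w, a * b, ?_, ?_, ?_⟩
    · calc _ = Bᵀ * (Aᵀ * J n * A) * B := by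
            rw [Matrix.transpose_mul]; simp only [Matrix.mul_assoc]
        _ = _ := by rw [hA, hB]
    · rcases ha with rfl | rfl <;> rcases hb with rfl | rfl <;> norm_num
    · rw [Matrix.GeneralLinearGroup.coe_mul, hg, hh, Matrix.fromBlocks_multiply]
      simp [smul_smul, mul_comm]
  inv_mem' := by
    rintro g ⟨A, v, a, hA, ha, hg⟩
    have hl : (J n * Aᵀ * J n) * A = 1 := by
      calc _ = J n * (Aᵀ * J n * A) := by simp only [Matrix.mul_assoc]
        _ = _ := by rw [hA, J_mul_J]
    have hr : A * (J n * Aᵀ * J n) = 1 := mul_eq_one_comm.mp hl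
    have haa : a * a = 1 := by rcases ha with rfl | rfl <;> norm_num
    refine ⟨J n * Aᵀ * J n, -(a • (v * (J n * Aᵀ * J n))), a, ?_, ha, ?_⟩
    · have hJt : (J n)ᵀ = J n := by simp [J]
      calc _ = J n * (A * (J n * Aᵀ * J n)) := by
            simp only [Matrix.transpose_mul, hJt, Matrix.transpose_transpose, Matrix.mul_assoc]
            simp only [← Matrix.mul_assoc, J_mul_J, Matrix.one_mul]
        _ = _ := by rw [hr, Matrix.mul_one]
    · have hprod : (g : Mat n) *
          Matrix.fromBlocks (J n * Aᵀ * J n) 0 (-(a • (v * (J n * Aᵀ * J n))))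
            (a • (1 : Matrix Unit Unit ℝ)) = 1 := by
        rw [hg, Matrix.fromBlocks_multiply, hr, ← Matrix.fromBlocks_one]
        congr 1
        · simp
        · simp
        · simp [smul_smul, haa]
        · simp [smul_smul, haa]
      rw [Matrix.coe_units_inv]
      exact Matrix.inv_eq_right_inv hprod

/-- The group `G_HP ⊆ PGL(n+1, ℝ)` of half-pipe isometries. -/
def GHP (n : ℕ) : Subgroup (PGL n) :=
  (halfPipeMatrices n).map Matrix.ProjGenLinGroup.mk

/-- The rescaling map `r_t = diag(1, …, 1, |t|⁻¹) ∈ PGL(n+1, ℝ)`, `t ≠ 0` (and `1` if `t = 0`). -/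
def resc (n : ℕ) (t : ℝ) : PGL n :=
  if ht : t = 0 then 1 else
    Matrix.ProjGenLinGroup.mk
      { val := Matrix.fromBlocks 1 0 0 (|t|⁻¹ • 1)
        inv := Matrix.fromBlocks 1 0 0 (|t| • 1)
        val_inv := by
          rw [Matrix.fromBlocks_multiply, ← Matrix.fromBlocks_one]
          simp [smul_smul, mul_inv_cancel₀ (abs_ne_zero.mpr ht)]
        inv_val := by
          rw [Matrix.fromBlocks_multiply, ← Matrix.fromBlocks_one]
          simp [smul_smul, inv_mul_cancel₀ (abs_ne_zero.mpr ht)] }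

/-! ### Smooth maps into projective space -/

section SmoothMaps

variable {n : ℕ} {E H N : Type*} [NormedAddCommGroup E] [NormedSpace ℝ E] [TopologicalSpace H]
  [TopologicalSpace N] [ChartedSpace H N]

/-- `f` lifts `D` to `ℝⁿ⁺¹ ∖ {0}` over the set `U`. -/
def IsLiftOn (f : N → Vec n) (D : N → RP n) (U : Set N) : Prop :=
  ∀ y ∈ U, ∃ h : f y ≠ 0, Projectivization.mk ℝ (f y) h = D y

/-- A map into `ℝPⁿ` is `C^k` on the open set `S` if near every point of `S` it has a `C^k` lift
to `ℝⁿ⁺¹ ∖ {0}`. -/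
def ProjContMDiffOn (I : ModelWithCorners ℝ E H) (k : ℕ∞) (D : N → RP n) (S : Set N) : Prop :=
  ∀ x ∈ S, ∃ f : N → Vec n, ∃ U ∈ 𝓝 x, ContMDiffOn I 𝓘(ℝ, Vec n) k f U ∧ IsLiftOn f D U

/-- `D` is a smooth map into `ℝPⁿ` with bijective differential at every point. The differential at
`x` is computed with a smooth local lift `f`, through the identification of the tangent space of
`ℝPⁿ` at `[v]` with `ℝⁿ⁺¹ / ℝv`. On a manifold without boundary this says that `D` is a
local diffeomorphism; at a boundary point it says that `D` extends to one in a chart. -/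
def IsProjLocalDiffeo (I : ModelWithCorners ℝ E H) (D : N → RP n) : Prop :=
  ∀ x, ∃ f : N → Vec n, ∃ U ∈ 𝓝 x, ContMDiffOn I 𝓘(ℝ, Vec n) ∞ f U ∧ IsLiftOn f D U ∧
    Function.Bijective fun v : TangentSpace I x =>
      (Submodule.span ℝ {f x}).mkQ (mfderiv I 𝓘(ℝ, Vec n) f x v : Vec n)

end SmoothMaps

/-- A path in `PGL(n+1, ℝ)` is `C^k` on the open set `S` of times if near every point of `S` it
lifts to a path of invertible matrices with `C^k` entries. -/
def PathContDiffOn {n : ℕ} (k : ℕ∞) (g : ℝ → PGL n) (S : Set ℝ) : Prop :=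
  ∀ t ∈ S, ∃ B : ℝ → GLGroup n, ∃ U ∈ 𝓝 t,
    (∀ i j, ContDiffOn ℝ k (fun u => (B u : Mat n) i j) U) ∧
      ∀ u ∈ U, Matrix.ProjGenLinGroup.mk (B u) = g u

/-! ### Universal covers, holonomy and developing maps -/

section Developing

variable {E H N M : Type*} [NormedAddCommGroup E] [NormedSpace ℝ E] [TopologicalSpace H]
  [TopologicalSpace N] [ChartedSpace H N] [TopologicalSpace M] [ChartedSpace H M]

/-- `p : N → M` is a universal cover of the smooth manifold `M`, where `N` carries the smooth
structure lifted from `M`. -/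
structure IsUniversalCover (I : ModelWithCorners ℝ E H) (p : N → M) : Prop where
  isCoveringMap : IsCoveringMap p
  surjective : Function.Surjective p
  simplyConnectedSpace : SimplyConnectedSpace N
  isLocalDiffeomorph : IsLocalDiffeomorph I I ∞ p

/-- The element of `π₁(M, x₀)` that corresponds to the deck transformation `φ` of `p : N → M`, where
`y₀` is a point over `x₀`: the class of the projection of a path `c` in `N` from `φ y₀` to `y₀`.
(Mathlib multiplies loops by `γ * δ = "first δ, then γ"`. With this convention it is the path
from `φ y₀` to `y₀`, not its inverse, that makes `φ ↦ [p ∘ c]` multiplicative.) -/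
def deckClass {p : N → M} (hp : Continuous p) {x₀ : M} {y₀ : N} (hy₀ : p y₀ = x₀)
    (φ : N ≃ₜ N) (hφ : ∀ y, p (φ y) = p y) (c : Path (φ y₀) y₀) : FundamentalGroup M x₀ :=
  FundamentalGroup.fromPath
    (Path.Homotopic.Quotient.mk ((c.map hp).cast ((hφ y₀).trans hy₀).symm hy₀.symm))

/-- `D : N → ℝPⁿ` is the developing map, on the universal cover `p : N → M`, of a `(G, Ω)`
structure on `M` with holonomy `ρ : π₁(M, x₀) → G`; here `Ω ⊆ ℝPⁿ` and `G ⊆ PGL(n+1, ℝ)`, and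
`y₀ ∈ N` is the base point over `x₀` through which `π₁(M, x₀)` acts on `N`. -/
structure IsDevelopingMap (I : ModelWithCorners ℝ E H) {n : ℕ} (Ω : Set (RP n))
    (G : Subgroup (PGL n)) {p : N → M} (hp : IsUniversalCover I p) {x₀ : M} {y₀ : N}
    (hy₀ : p y₀ = x₀) (ρ : FundamentalGroup M x₀ →* G) (D : N → RP n) : Prop where
  mem : ∀ y, D y ∈ Ω
  isLocalDiffeo : IsProjLocalDiffeo I D
  equivariant : ∀ (φ : N ≃ₜ N) (hφ : ∀ y, p (φ y) = p y) (c : Path (φ y₀) y₀) (y : N),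
    D (φ y) = (ρ (deckClass hp.isCoveringMap.continuous hy₀ φ hφ c) : PGL n) • D y

end Developing

/-! ### Thickenings and first order compatibility -/

/-- The manifold `M` (without boundary) is a thickening of the manifold with boundary `M₀`: the
inclusion `ι : M₀ → M` is a smooth embedding of codimension `0` and `M ∖ M₀` is an (open) collar
of `∂M₀`. -/
structure IsThickening (n : ℕ) [NeZero n] {M₀ M : Type*}
    [TopologicalSpace M₀] [ChartedSpace (EuclideanHalfSpace n) M₀]
    [TopologicalSpace M] [ChartedSpace (EuclideanSpace ℝ (Fin n)) M] (ι : C(M₀, M)) : Prop where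
  contMDiff : ContMDiff (𝓡∂ n) (𝓡 n) ∞ ι
  isEmbedding : IsEmbedding ι
  bijective_mfderiv : ∀ x, Function.Bijective (mfderiv (𝓡∂ n) (𝓡 n) ι x)
  exists_collar : ∃ c : (𝓡∂ n).boundary M₀ × Ico (0 : ℝ) 1 → M, IsEmbedding c ∧
    (∀ x, c (x, ⟨0, by simp⟩) = ι x) ∧ c '' {q | 0 < (q.2 : ℝ)} = (range ι)ᶜ

/-- The times `t` with `0 < |t| < ε` and the sign of `s`: for `s = 1` the interval `(0, ε)`, for
`s = -1` the interval `(-ε, 0)`. -/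
def times (s ε : ℝ) : Set ℝ := {t | 0 < s * t ∧ |t| < ε}

/-- The family `ρ_t` of representations of `Γ` is compatible to first order at `t = 0` with `σ`:
`r_t ρ_t(γ) r_t⁻¹ → σ(γ)` in `PGL(n+1, ℝ)` for every `γ`, as `t → 0` through the times with the
sign of `s`. -/
def CompatibleToFirstOrder {n : ℕ} {Γ : Type*} [Group Γ] {G G' : Subgroup (PGL n)} (s : ℝ)
    (ρ : ℝ → Γ →* G) (σ : Γ →* G') : Prop :=
  ∀ γ, Tendsto (fun t => resc n t * (ρ t γ : PGL n) * (resc n t)⁻¹) (𝓝[{t | 0 < s * t}] 0)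
    (𝓝 (σ γ : PGL n))

end HalfPipe

end

/-! Lift the inclusion to a map `L` of universal covers, and let `d` be the lift of `D ∘ L` to
vectors with timelike coordinate 1. For a deck transformation `γ` let `a₀ γ` be the matrix of its
half-pipe holonomy that keeps the future cone; having no sign ambiguity, these matrices form a
linear representation. Take a compactly supported bump function `χ ≥ 0` whose translates have no
common zero, and put `w₀ y = ∑ γ, a₀ γ *ᵥ (χ d)(γ⁻¹ y)`. Every term is a nonnegative multiple of `d
y`, so `w₀` is a positive function times `d` and defines the same map to projective space
(`wsum_eq_smul`, `wsum_coord_pos`).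

Unlike `d`, this sum can be perturbed together with the holonomy. Replace `a₀ γ` by the nearby
matrix that represents `r_t ρ_t(γ) r_t⁻¹` (`tendsto_lift`). The new sum `w_t` is equivariant by
reindexing (`wsum_smul`). On the compact support `K` of `χ` only finitely many `γ` contribute, so
being an immersion and being negative for the form, which hold for `w₀` and `η₀`, persist for `w_t`
and `η_t` when `t` is small (`eventually_isSmallTime`). Applying `r_t⁻¹` undoes the conjugation and
turns `η_t` into `η_s` (`eta_lastDiag_mulVec`), so the line of `r_t⁻¹ w_t` develops an `X` structure
with holonomy `ρ_t`.

Representations into `PGL` lift to matrices only up to sign, and the signs are controlled only on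
the finite set `S` of `γ` with `γK ∩ K ≠ ∅`. Therefore `w_t` is used on `K` alone and spread over
the cover by `ρ_t`; `IsSmallTime.family_eq` shows that the choices do not matter. The result is
locally a finite sum whose coefficients are as regular in `t` as `ρ_t`. -/

noncomputable section

namespace HalfPipe

/-! ### Normalized lifts of projective transformations -/

section Lifts

variable {n : ℕ}

/-- The positive multiple of an invertible matrix whose determinant is `±1`. -/
def unimod (B : Mat n) : Mat n :=
  ((B.det ^ 2) ^ (-(2 * (Fintype.card (Fin n ⊕ Unit) : ℝ))⁻¹) : ℝ) • B

/-- Scaling by `c` multiplies the squared determinant by `c` to twice the matrix size, which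
dictates the exponent in `unimod`. -/
theorem det_unimod_sq {B : Mat n} (hB : B.det ≠ 0) : (unimod B).det ^ 2 = 1 := by
  have hpos : 0 < B.det ^ 2 := by positivity
  have hc : (Fintype.card (Fin n ⊕ Unit) : ℝ) ≠ 0 := by simp; positivity
  rw [unimod, Matrix.det_smul, mul_pow, ← pow_mul, ← Real.rpow_natCast, ← Real.rpow_mul hpos.le]
  push_cast
  have : -(2 * (Fintype.card (Fin n ⊕ Unit) : ℝ))⁻¹ * (Fintype.card (Fin n ⊕ Unit) * 2) = -1 := by
    field_simp
  rw [this, Real.rpow_neg_one, inv_mul_cancel₀ hpos.ne']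

theorem unimod_eq_self {B : Mat n} (hB : B.det ^ 2 = 1) : unimod B = B := by
  simp [unimod, hB]

/-- The entrywise inner product of matrices. -/
def frob (A B : Mat n) : ℝ := ∑ i, ∑ j, A i j * B i j

theorem frob_neg (A B : Mat n) : frob (-A) B = -frob A B := by
  simp only [frob, Matrix.neg_apply, neg_mul, Finset.sum_neg_distrib]

theorem frob_self_pos {A : Mat n} (hA : A ≠ 0) : 0 < frob A A := by
  have h0 : 0 ≤ frob A A :=
    Finset.sum_nonneg fun i _ => Finset.sum_nonneg fun j _ => mul_self_nonneg _
  refine lt_of_le_of_ne h0 fun h => hA ?_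
  ext i j
  have h1 := (Finset.sum_eq_zero_iff_of_nonneg
    (fun i _ => Finset.sum_nonneg fun j _ => mul_self_nonneg _)).1 h.symm i (Finset.mem_univ _)
  have h2 := (Finset.sum_eq_zero_iff_of_nonneg (fun j _ => mul_self_nonneg _)).1 h1 j
    (Finset.mem_univ _)
  simpa using h2

theorem continuous_frob (B : Mat n) : Continuous fun A : Mat n => frob A B := by
  unfold frob
  fun_prop

/-- `A` is a matrix of determinant `±1` that represents `g`. -/
def IsLift (A : Mat n) (g : PGL n) : Prop :=
  A.det ^ 2 = 1 ∧ ∃ B : GLGroup n, Matrix.ProjGenLinGroup.mk B = g ∧ (B : Mat n) = A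

theorem IsLift.ne_zero {A : Mat n} {g : PGL n} (h : IsLift A g) : A ≠ 0 := by
  rintro rfl
  simpa using h.1

theorem IsLift.neg {A : Mat n} {g : PGL n} (h : IsLift A g) : IsLift (-A) g := by
  obtain ⟨hd, B, hB, rfl⟩ := h
  refine ⟨?_, -B, ?_, by simp⟩
  · rw [Matrix.det_neg, mul_pow, hd, mul_one, ← pow_mul, (even_two.mul_left _).neg_one_pow]
  · rw [← hB]
    refine Matrix.ProjGenLinGroup.mk_eq_mk_iff.2 ⟨-1, ?_⟩
    ext i j
    simp

theorem IsLift.mul {A A' : Mat n} {g g' : PGL n} (h : IsLift A g) (h' : IsLift A' g') :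
    IsLift (A * A') (g * g') := by
  obtain ⟨hd, B, rfl, rfl⟩ := h
  obtain ⟨hd', B', rfl, rfl⟩ := h'
  refine ⟨?_, B * B', map_mul _ _ _, rfl⟩
  rw [Matrix.det_mul, mul_pow, hd, hd', one_mul]

theorem isLift_unimod (B : GLGroup n) :
    IsLift (unimod (B : Mat n)) (Matrix.ProjGenLinGroup.mk B) := by
  have hdet : (B : Mat n).det ≠ 0 := by
    simpa using (Matrix.isUnit_iff_isUnit_det (B : Mat n)).1 B.isUnit
  refine ⟨det_unimod_sq hdet, ?_⟩
  set c : ℝ := ((B : Mat n).det ^ 2) ^ (-(2 * (Fintype.card (Fin n ⊕ Unit) : ℝ))⁻¹) with hc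
  have hc0 : c ≠ 0 := (Real.rpow_pos_of_pos (by positivity) _).ne'
  refine ⟨B * .scalar _ (Units.mk0 c hc0), ?_, ?_⟩
  · simp
  · ext i j
    rw [unimod, ← hc]
    simp [mul_comm]

/-- Two representatives differ by a real scalar `u`; comparing determinants gives `(u ^ 2) ^ (n + 1)
= 1`, hence `u ^ 2 = 1`. -/
theorem IsLift.eq_or_eq_neg {A A' : Mat n} {g : PGL n} (h : IsLift A g) (h' : IsLift A' g) :
    A' = A ∨ A' = -A := by
  obtain ⟨hd, B, rfl, rfl⟩ := h
  obtain ⟨hd', B', hB, rfl⟩ := h'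
  obtain ⟨u, rfl⟩ := Matrix.ProjGenLinGroup.mk_eq_mk_iff.1 hB.symm
  have hval : ((B * .scalar _ u : GLGroup n) : Mat n) = (u : ℝ) • (B : Mat n) := by
    ext i j
    simp [mul_comm]
  rw [hval, Matrix.det_smul, mul_pow, hd, mul_one, ← pow_mul, mul_comm, pow_mul] at hd'
  have hu2 : (u : ℝ) ^ 2 = 1 := by
    refine (pow_eq_one_iff_of_nonneg (sq_nonneg _) ?_).1 hd'
    simp
  rw [hval]
  have h0 : ((u : ℝ) - 1) * (u + 1) = 0 := by linear_combination hu2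
  rcases mul_eq_zero.1 h0 with h | h
  · simp [sub_eq_zero.1 h]
  · simp [eq_neg_of_add_eq_zero_left h]

open Classical in
/-- The matrix of determinant `±1` that represents `g` and has nonnegative inner product
with `m`. -/
def lift (g : PGL n) (m : Mat n) : Mat n :=
  let A := unimod ((Matrix.ProjGenLinGroup.mk_surjective g).choose : Mat n)
  if 0 ≤ frob A m then A else -A

theorem isLift_lift (g : PGL n) (m : Mat n) : IsLift (lift g m) g := by
  have h := isLift_unimod (Matrix.ProjGenLinGroup.mk_surjective g).choose
  rw [(Matrix.ProjGenLinGroup.mk_surjective g).choose_spec] at h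
  unfold lift
  dsimp only
  split_ifs
  exacts [h, h.neg]

theorem frob_lift_nonneg (g : PGL n) (m : Mat n) : 0 ≤ frob (lift g m) m := by
  unfold lift
  dsimp only
  split_ifs with h
  · exact h
  · rw [frob_neg]
    linarith

/-- Strict positivity is needed: when the inner product vanishes, both signs satisfy the condition
in `lift`. -/
theorem IsLift.eq_lift {A : Mat n} {g : PGL n} (h : IsLift A g) {m : Mat n}
    (hm : 0 < frob A m) : A = lift g m := by
  rcases (isLift_lift g m).eq_or_eq_neg h with h1 | h1
  · exact h1
  · have := frob_lift_nonneg g m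
    rw [h1, frob_neg] at hm
    linarith

theorem continuousAt_unimod {B : Mat n} (hB : B.det ≠ 0) : ContinuousAt unimod B := by
  unfold unimod
  have h : Continuous fun C : Mat n => C.det := Continuous.matrix_det continuous_id
  have hsq : ContinuousAt (fun C : Mat n => C.det ^ 2) B := (h.pow 2).continuousAt
  have hB2 : B.det ^ 2 ≠ 0 := pow_ne_zero 2 hB
  exact (hsq.rpow_const (Or.inl hB2)).smul (continuousAt_id (X := Mat n))

theorem isOpenMap_mk : IsOpenMap (Matrix.ProjGenLinGroup.mk : GLGroup n → PGL n) :=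
  QuotientGroup.isOpenMap_coe (N := Subgroup.center (GLGroup n))

/-- The quotient map to `PGL` is open, so elements near `g₀` are classes of matrices near a
representative of `g₀`. Normalizing keeps them near `m`, and their positive inner product with `m`
identifies them with the chosen lift. -/
theorem tendsto_lift {α : Type*} {l : Filter α} {g : α → PGL n} {g₀ : PGL n} {m : Mat n}
    (hg : Tendsto g l (𝓝 g₀)) (hm : IsLift m g₀) :
    Tendsto (fun a => lift (g a) m) l (𝓝 m) := by
  obtain ⟨B, hB, hBm⟩ := hm.2
  intro V hV
  have hu : unimod m = m := unimod_eq_self hm.1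
  have hdet : m.det ≠ 0 := fun h => by simpa [h] using hm.1
  have hc : ContinuousAt (fun C : GLGroup n => unimod (C : Mat n)) B := by
    refine ContinuousAt.comp (g := unimod) ?_ Units.continuous_val.continuousAt
    rw [hBm]
    exact continuousAt_unimod hdet
  have hV' : ∀ᶠ C : GLGroup n in 𝓝 B, unimod (C : Mat n) ∈ V :=
    hc (by simpa only [hBm, hu] using hV)
  have hp : ∀ᶠ C : GLGroup n in 𝓝 B, 0 < frob (unimod (C : Mat n)) m := by
    refine ((continuous_frob m).continuousAt.comp hc).eventually (lt_mem_nhds ?_)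
    simp only [Function.comp_apply, hBm, hu]
    exact frob_self_pos hm.ne_zero
  have him := isOpenMap_mk.image_mem_nhds (hV'.and hp)
  rw [hB] at him
  rw [mem_map]
  filter_upwards [hg.eventually him] with a ha
  obtain ⟨C, ⟨hC1, hC2⟩, hC⟩ := ha
  change lift (g a) m ∈ V
  rw [← hC, ← (isLift_unimod C).eq_lift hC2]
  exact hC1

theorem contDiffOn_unimod {k : ℕ∞} {U : Set ℝ} {B : ℝ → GLGroup n}
    (hB : ∀ i j, ContDiffOn ℝ k (fun u => (B u : Mat n) i j) U) (i j : Fin n ⊕ Unit) :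
    ContDiffOn ℝ k (fun u => unimod (B u : Mat n) i j) U := by
  have hdet : ContDiffOn ℝ k (fun u => (B u : Mat n).det) U := by
    simp only [Matrix.det_apply]
    refine ContDiffOn.sum fun σ _ => ContDiffOn.const_smul _ ?_
    exact contDiffOn_prod fun i _ => hB _ _
  simp only [unimod, Matrix.smul_apply, smul_eq_mul]
  refine ContDiffOn.mul ?_ (hB i j)
  refine ContDiffOn.rpow_const_of_ne (hdet.pow 2) fun u _ => ?_
  have : (B u : Mat n).det ≠ 0 := by
    simpa using (Matrix.isUnit_iff_isUnit_det (B u : Mat n)).1 (B u).isUnit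
  positivity

/-- As long as the inner product with `m` does not vanish, its sign is locally constant, so near `t`
the chosen lift is `unimod (B u)` up to one fixed sign. -/
theorem exists_contDiffOn_lift {k : ℕ∞} {g : ℝ → PGL n} {B : ℝ → GLGroup n} {t : ℝ} {U : Set ℝ}
    (hU : U ∈ 𝓝 t) (hB : ∀ i j, ContDiffOn ℝ k (fun u => (B u : Mat n) i j) U)
    (hBg : ∀ u ∈ U, Matrix.ProjGenLinGroup.mk (B u) = g u) {m : Mat n}
    (hm : 0 < frob (lift (g t) m) m) :
    ∃ V ∈ 𝓝 t, ∀ i j, ContDiffOn ℝ k (fun u => lift (g u) m i j) V := by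
  have hA := contDiffOn_unimod hB
  have hlift : ∀ u ∈ U, IsLift (unimod (B u : Mat n)) (g u) := fun u hu =>
    hBg u hu ▸ isLift_unimod (B u)
  have hcont : ContinuousAt (fun u => frob (unimod (B u : Mat n)) m) t := by
    have : ContinuousAt (fun u => unimod (B u : Mat n)) t := by
      refine continuousAt_pi.2 fun i => continuousAt_pi.2 fun j => ?_
      exact (hA i j).continuousOn.continuousAt hU
    exact (continuous_frob m).continuousAt.comp this
  rcases (isLift_lift (g t) m).eq_or_eq_neg (hlift t (mem_of_mem_nhds hU)) with h | h
  · have hpos : ∀ᶠ u in 𝓝 t, 0 < frob (unimod (B u : Mat n)) m :=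
      hcont.eventually (lt_mem_nhds (by simpa only [h] using hm))
    refine ⟨_, inter_mem hU hpos, fun i j => ((hA i j).mono inter_subset_left).congr ?_⟩
    rintro u ⟨hu, hu'⟩
    exact congrFun (congrFun ((hlift u hu).eq_lift hu').symm i) j
  · have hneg : ∀ᶠ u in 𝓝 t, frob (unimod (B u : Mat n)) m < 0 :=
      hcont.eventually (gt_mem_nhds (by simpa only [h, frob_neg, neg_lt_zero] using hm))
    refine ⟨_, inter_mem hU hneg, fun i j => ((hA i j).mono inter_subset_left).neg.congr ?_⟩
    rintro u ⟨hu, hu'⟩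
    have hu'' : 0 < frob (-unimod (B u : Mat n)) m := by
      rw [frob_neg]
      exact neg_pos.2 hu'
    exact congrFun (congrFun ((hlift u hu).neg.eq_lift hu'').symm i) j

end Lifts

/-! ### Points of projective space -/

section Points

variable {n : ℕ}

instance : Nonempty (RP n) :=
  ⟨Projectivization.mk ℝ (fun _ => 1) fun h => by simpa using congrFun h (Sum.inr ())⟩

open Classical in
/-- The line through `v` (an arbitrary line if `v = 0`). -/
def toRP (v : Vec n) : RP n :=
  if h : v ≠ 0 then Projectivization.mk ℝ v h else Classical.arbitrary _

theorem toRP_of_ne {v : Vec n} (h : v ≠ 0) : toRP v = Projectivization.mk ℝ v h := dif_pos h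

theorem toRP_rep (P : RP n) : toRP P.rep = P := by
  rw [toRP_of_ne P.rep_nonzero, Projectivization.mk_rep]

theorem toRP_eq_toRP_iff {v w : Vec n} (hv : v ≠ 0) (hw : w ≠ 0) :
    toRP v = toRP w ↔ ∃ c : ℝ, c • w = v := by
  rw [toRP_of_ne hv, toRP_of_ne hw, Projectivization.mk_eq_mk_iff']

theorem toRP_smul {v : Vec n} {c : ℝ} (hc : c ≠ 0) : toRP (c • v) = toRP v := by
  by_cases hv : v = 0
  · simp [hv]
  · exact (toRP_eq_toRP_iff (smul_ne_zero hc hv) hv).2 ⟨c, rfl⟩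

theorem GL_mulVec_ne_zero (B : GLGroup n) {v : Vec n} (hv : v ≠ 0) :
    (B : Mat n) *ᵥ v ≠ 0 := by
  intro h
  apply hv
  have := congrArg (fun w => ((B⁻¹ : GLGroup n) : Mat n) *ᵥ w) h
  simpa only [Matrix.mulVec_mulVec, Units.inv_mul, Matrix.one_mulVec, Matrix.mulVec_zero]
    using this

theorem mk_smul_toRP (B : GLGroup n) {v : Vec n} (hv : v ≠ 0) :
    Matrix.ProjGenLinGroup.mk B • toRP v = toRP ((B : Mat n) *ᵥ v) := by
  rw [toRP_of_ne hv, toRP_of_ne (GL_mulVec_ne_zero B hv)]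
  rfl

theorem IsLift.smul_toRP {A : Mat n} {g : PGL n} (h : IsLift A g) {v : Vec n} (hv : v ≠ 0) :
    g • toRP v = toRP (A *ᵥ v) := by
  obtain ⟨-, B, rfl, rfl⟩ := h
  exact mk_smul_toRP B hv

theorem IsLift.mulVec_ne_zero {A : Mat n} {g : PGL n} (h : IsLift A g) {v : Vec n} (hv : v ≠ 0) :
    A *ᵥ v ≠ 0 := by
  obtain ⟨-, B, rfl, rfl⟩ := h
  exact GL_mulVec_ne_zero B hv

theorem toRP_mem_X {s : ℝ} {v : Vec n} (hv : v ≠ 0) :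
    toRP v ∈ X n s ↔ v ⬝ᵥ (eta n s *ᵥ v) < 0 := by
  rw [toRP_of_ne hv, mk_mem_X]

theorem isLiftOn_iff {N : Type*} {f : N → Vec n} {D : N → RP n} {U : Set N} :
    IsLiftOn f D U ↔ ∀ y ∈ U, f y ≠ 0 ∧ toRP (f y) = D y := by
  refine forall₂_congr fun y _ => ⟨fun ⟨h, h'⟩ => ⟨h, by rw [toRP_of_ne h, h']⟩,
    fun ⟨h, h'⟩ => ⟨h, by rw [← h', toRP_of_ne h]⟩⟩

end Points

/-! ### The forms `η_s` -/

section Forms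

variable {n : ℕ}

theorem dotProduct_eta_mulVec (s : ℝ) (v w : Vec n) :
    v ⬝ᵥ (eta n s *ᵥ w) =
      ∑ i : Fin n, (if (i : ℕ) = 0 then -1 else 1) * (v (.inl i) * w (.inl i))
        + (SignType.sign s : ℝ) * s ^ 2 * (v (.inr ()) * w (.inr ())) := by
  rw [← Sum.elim_comp_inl_inr w, eta, Matrix.fromBlocks_mulVec]
  simp only [dotProduct, Fintype.sum_sum_type, Sum.elim_inl, Sum.elim_inr, J,
    Matrix.zero_mulVec, add_zero, zero_add, Matrix.mulVec_diagonal, Matrix.smul_mulVec,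
    Matrix.one_mulVec, Function.comp_apply, Pi.smul_apply, smul_eq_mul, Finset.univ_unique,
    Finset.sum_singleton]
  congr 1
  · exact Finset.sum_congr rfl fun i _ => by ring
  · simp only [PUnit.default_eq_unit]
    ring

/-- In the form `s * |s|` the last coefficient is visibly continuous at `s = 0`, where the geometry
degenerates. -/
theorem sign_mul_sq (s : ℝ) : (SignType.sign s : ℝ) * s ^ 2 = s * |s| := by
  rw [← sign_mul_abs s, ← sq_abs]
  rcases lt_trichotomy s 0 with h | h | h <;> simp [h, abs_of_neg, abs_of_pos, sq]

theorem dotProduct_mulVec_of_preserves {A η : Mat n} (hA : Aᵀ * η * A = η) (v w : Vec n) :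
    (A *ᵥ v) ⬝ᵥ (η *ᵥ (A *ᵥ w)) = v ⬝ᵥ (η *ᵥ w) := by
  conv_rhs => rw [← hA]
  rw [Matrix.mulVec_mulVec, ← Matrix.vecMul_transpose, ← Matrix.dotProduct_mulVec,
    Matrix.mulVec_mulVec, Matrix.mul_assoc]

theorem ne_zero_of_neg {η : Mat n} {v : Vec n} (hv : v ⬝ᵥ (η *ᵥ v) < 0) : v ≠ 0 := by
  rintro rfl
  simp at hv

theorem isom_smul_mem_X {s : ℝ} {g : PGL n} (hg : g ∈ isom n s) {P : RP n} (hP : P ∈ X n s) :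
    g • P ∈ X n s := by
  obtain ⟨B, hB, rfl⟩ := hg
  have hB' : (B : Mat n)ᵀ * eta n s * (B : Mat n) = eta n s := hB
  rw [← toRP_rep P, toRP_mem_X P.rep_nonzero] at hP
  rw [← toRP_rep P, mk_smul_toRP B P.rep_nonzero, toRP_mem_X (GL_mulVec_ne_zero B P.rep_nonzero),
    dotProduct_mulVec_of_preserves hB']
  exact hP

theorem eta_comm (s : ℝ) (v w : Vec n) : v ⬝ᵥ (eta n s *ᵥ w) = w ⬝ᵥ (eta n s *ᵥ v) := by
  simp only [dotProduct_eta_mulVec, mul_comm]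

theorem halfPipeMatrices_preserves {g : GLGroup n} (hg : g ∈ halfPipeMatrices n) :
    (g : Mat n)ᵀ * eta n 0 * (g : Mat n) = eta n 0 ∧ (g : Mat n).det ^ 2 = 1 := by
  obtain ⟨A, v, a, hA, ha, h⟩ := hg
  constructor
  · rw [h, eta, Matrix.fromBlocks_transpose, Matrix.fromBlocks_multiply,
      Matrix.fromBlocks_multiply]
    simp [hA]
  · rw [h, Matrix.det_fromBlocks_zero₁₂]
    have hdet : A.det ^ 2 = 1 := by
      have h1 := congrArg Matrix.det hA
      have h2 : (J n).det * (J n).det = 1 := by rw [← Matrix.det_mul, J_mul_J, Matrix.det_one]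
      rw [Matrix.det_mul, Matrix.det_mul, Matrix.det_transpose] at h1
      -- Multiply `det A * det J * det A = det J` by `det J` and use `(det J) ^ 2 = 1`.
      linear_combination (J n).det * h1 + (1 - A.det ^ 2) * h2
    rcases ha with rfl | rfl <;> simp [hdet]

end Forms

/-! ### The future cone of the half-pipe form -/

section Cone

variable {n : ℕ} [NeZero n]

/-- The index of the timelike coordinate. -/
abbrev i₀ (n : ℕ) [NeZero n] : Fin n ⊕ Unit := .inl 0

/-- The timelike coordinate is the only one that contributes negatively; the last one does not
contribute at all. -/
theorem eta_zero_nonneg {v : Vec n} (h0 : v (i₀ n) = 0) : 0 ≤ v ⬝ᵥ (eta n 0 *ᵥ v) := by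
  rw [dotProduct_eta_mulVec]
  simp only [sign_zero, SignType.coe_zero, zero_mul, add_zero]
  refine Finset.sum_nonneg fun i _ => ?_
  split_ifs with hi
  · have : i = 0 := Fin.ext (by simpa using hi)
    rw [this, h0]
    simp
  · nlinarith [mul_self_nonneg (v (.inl i))]

theorem coord_ne_zero {v : Vec n} (hv : v ⬝ᵥ (eta n 0 *ᵥ v) < 0) : v (i₀ n) ≠ 0 :=
  fun h => (eta_zero_nonneg h).not_gt hv

/-- The reversed Cauchy-Schwarz inequality, in qualitative form. -/
theorem coord_mul_coord_mul_eta_neg {v w : Vec n} (hv : v ⬝ᵥ (eta n 0 *ᵥ v) < 0)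
    (hw : w ⬝ᵥ (eta n 0 *ᵥ w) < 0) :
    v (i₀ n) * w (i₀ n) * (v ⬝ᵥ (eta n 0 *ᵥ w)) < 0 := by
  set a := v (i₀ n)
  set b := w (i₀ n)
  -- This combination is chosen to have timelike coordinate 0; expanding its norm isolates the mixed
  -- term.
  have h := eta_zero_nonneg (v := b • v - a • w) (by simp [a, b, mul_comm])
  have hexp : (b • v - a • w) ⬝ᵥ (eta n 0 *ᵥ (b • v - a • w)) =
      b ^ 2 * (v ⬝ᵥ (eta n 0 *ᵥ v)) - 2 * (a * b * (v ⬝ᵥ (eta n 0 *ᵥ w)))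
        + a ^ 2 * (w ⬝ᵥ (eta n 0 *ᵥ w)) := by
    simp only [Matrix.mulVec_sub, Matrix.mulVec_smul, dotProduct_sub, sub_dotProduct,
      smul_dotProduct, dotProduct_smul, smul_eq_mul, eta_comm 0 w v]
    ring
  have ha : 0 < a ^ 2 := by
    have := coord_ne_zero hv
    positivity
  have hb : 0 < b ^ 2 := by
    have := coord_ne_zero hw
    positivity
  nlinarith [mul_neg_of_pos_of_neg hb hv, mul_neg_of_pos_of_neg ha hw]

/-- The vector `(1, 0, …, 0)`. -/
def e₀ (n : ℕ) [NeZero n] : Vec n := Pi.single (i₀ n) 1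

theorem e₀_coord : e₀ n (i₀ n) = 1 := by simp [e₀]

theorem e₀_neg : e₀ n ⬝ᵥ (eta n 0 *ᵥ e₀ n) < 0 := by
  simp [e₀, eta, J]

/-- `A` is a matrix of determinant `±1` that represents `g`, preserves the form `η₀` and maps its
future cone to itself. -/
structure IsPosLift (A : Mat n) (g : PGL n) : Prop where
  isLift : IsLift A g
  preserves : Aᵀ * eta n 0 * A = eta n 0
  pos : ∀ v : Vec n, v ⬝ᵥ (eta n 0 *ᵥ v) < 0 → 0 < v (i₀ n) → 0 < (A *ᵥ v) (i₀ n)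

/-- By the reversed Cauchy-Schwarz inequality, two timelike vectors lie in the same half of the cone
exactly when their product is negative, and `A` preserves that product. -/
theorem coord_mulVec_mul_coord_mulVec_pos {A : Mat n} (hA : Aᵀ * eta n 0 * A = eta n 0)
    {v w : Vec n} (hv : v ⬝ᵥ (eta n 0 *ᵥ v) < 0) (hw : w ⬝ᵥ (eta n 0 *ᵥ w) < 0)
    (hv0 : 0 < v (i₀ n)) (hw0 : 0 < w (i₀ n)) :
    0 < (A *ᵥ v) (i₀ n) * (A *ᵥ w) (i₀ n) := by
  have h1 := coord_mul_coord_mul_eta_neg hv hw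
  have h2 := coord_mul_coord_mul_eta_neg (v := A *ᵥ v) (w := A *ᵥ w)
    (by rwa [dotProduct_mulVec_of_preserves hA]) (by rwa [dotProduct_mulVec_of_preserves hA])
  rw [dotProduct_mulVec_of_preserves hA] at h2
  have h3 : v ⬝ᵥ (eta n 0 *ᵥ w) < 0 := by
    by_contra h
    exact absurd h1 (not_lt.2 (mul_nonneg (mul_pos hv0 hw0).le (not_lt.1 h)))
  by_contra h
  exact absurd h2 (not_lt.2 (mul_nonneg_of_nonpos_of_nonpos (not_lt.1 h) h3.le))

/-- The image of the single vector `e₀` decides the sign for the whole future cone. -/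
theorem exists_isPosLift {g : PGL n} (hg : g ∈ GHP n) : ∃ A, IsPosLift A g := by
  obtain ⟨B, hB, rfl⟩ := hg
  obtain ⟨hp, hd⟩ := halfPipeMatrices_preserves hB
  have hl : IsLift (B : Mat n) (Matrix.ProjGenLinGroup.mk B) := ⟨hd, B, rfl, rfl⟩
  have hne : ((B : Mat n) *ᵥ e₀ n) (i₀ n) ≠ 0 :=
    coord_ne_zero (by rw [dotProduct_mulVec_of_preserves hp]; exact e₀_neg)
  have he : 0 < e₀ n (i₀ n) := by simp [e₀_coord]
  rcases hne.lt_or_gt with h | h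
  · refine ⟨-(B : Mat n), hl.neg, by simp [hp], fun v hv hv0 => ?_⟩
    have := coord_mulVec_mul_coord_mulVec_pos hp hv e₀_neg hv0 he
    simpa [Matrix.neg_mulVec] using neg_of_mul_pos_left this h.le
  · refine ⟨B, hl, hp, fun v hv hv0 => ?_⟩
    have := coord_mulVec_mul_coord_mulVec_pos hp hv e₀_neg hv0 he
    exact pos_of_mul_pos_left this h.le

theorem IsPosLift.mul {A A' : Mat n} {g g' : PGL n} (h : IsPosLift A g) (h' : IsPosLift A' g') :
    IsPosLift (A * A') (g * g') where
  isLift := h.isLift.mul h'.isLift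
  preserves := by
    calc _ = A'ᵀ * (Aᵀ * eta n 0 * A) * A' := by
            rw [Matrix.transpose_mul]; simp only [Matrix.mul_assoc]
      _ = _ := by rw [h.preserves, h'.preserves]
  pos v hv hv0 := by
    rw [← Matrix.mulVec_mulVec]
    refine h.pos _ ?_ (h'.pos v hv hv0)
    rwa [dotProduct_mulVec_of_preserves h'.preserves]

/-- Together with `IsPosLift.mul`, this makes the future-preserving lifts multiplicative with no
sign error. -/
theorem IsPosLift.eq {A A' : Mat n} {g : PGL n} (h : IsPosLift A g) (h' : IsPosLift A' g) :
    A' = A := by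
  rcases h.isLift.eq_or_eq_neg h'.isLift with h1 | h1
  · exact h1
  · have he : 0 < e₀ n (i₀ n) := by simp [e₀_coord]
    have h2 := h.pos _ e₀_neg he
    have h3 := h'.pos _ e₀_neg he
    rw [h1, Matrix.neg_mulVec, Pi.neg_apply] at h3
    linarith

/-- The representative with timelike coordinate `1` of a point of half-pipe space. -/
def affineRep (P : RP n) : Vec n := (P.rep (i₀ n))⁻¹ • P.rep

theorem affineRep_eq {v : Vec n} (hv : v ≠ 0) : affineRep (toRP v) = (v (i₀ n))⁻¹ • v := by
  obtain ⟨c, hc⟩ := (toRP_eq_toRP_iff (toRP v).rep_nonzero hv).1 (toRP_rep _)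
  have hc0 : c ≠ 0 := by
    rintro rfl
    exact (toRP v).rep_nonzero (by simpa using hc.symm)
  rw [affineRep, ← hc, Pi.smul_apply, smul_smul, smul_eq_mul, mul_inv, mul_comm c⁻¹, mul_assoc,
    inv_mul_cancel₀ hc0, mul_one]

theorem affineRep_spec {P : RP n} (hP : P ∈ X n 0) :
    affineRep P (i₀ n) = 1 ∧ affineRep P ≠ 0 ∧ toRP (affineRep P) = P ∧
      affineRep P ⬝ᵥ (eta n 0 *ᵥ affineRep P) < 0 := by
  have h0 : P.rep (i₀ n) ≠ 0 := coord_ne_zero hP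
  have hr : toRP (affineRep P) = P := by rw [affineRep, toRP_smul (inv_ne_zero h0), toRP_rep]
  have hne : affineRep P ≠ 0 := smul_ne_zero (inv_ne_zero h0) P.rep_nonzero
  refine ⟨?_, hne, hr, ?_⟩
  · simp [affineRep, h0]
  · rw [← toRP_mem_X hne, hr]
    exact hP

theorem IsPosLift.mulVec_affineRep {A : Mat n} {g : PGL n} (h : IsPosLift A g) {P : RP n}
    (hP : P ∈ X n 0) :
    0 < (A *ᵥ affineRep P) (i₀ n) ∧
      A *ᵥ affineRep P = (A *ᵥ affineRep P) (i₀ n) • affineRep (g • P) := by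
  obtain ⟨h1, hne, hr, hneg⟩ := affineRep_spec hP
  have hpos := h.pos _ hneg (by simp [h1])
  refine ⟨hpos, ?_⟩
  conv_rhs => rw [← hr, h.isLift.smul_toRP hne, affineRep_eq (h.isLift.mulVec_ne_zero hne), hr]
  rw [smul_smul, mul_inv_cancel₀ hpos.ne', one_smul]

end Cone

/-! ### Immersions into projective space -/

section Transverse

variable {E V V' : Type*} [NormedAddCommGroup E] [NormedSpace ℝ E]
  [NormedAddCommGroup V] [NormedSpace ℝ V] [NormedAddCommGroup V'] [NormedSpace ℝ V']

/-- `L` is injective modulo the line spanned by the nonzero vector `w`. -/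
def Transverse (L : E →L[ℝ] V) (w : V) : Prop :=
  ∀ (v : E) (c : ℝ), L v + c • w = 0 → v = 0 ∧ c = 0

theorem Transverse.ne_zero {L : E →L[ℝ] V} {w : V} (h : Transverse L w) : w ≠ 0 := fun hw =>
  one_ne_zero (h 0 1 (by simp [hw])).2

/-- The quotient by the line has the dimension of `E`, so injectivity already gives bijectivity. -/
theorem transverse_iff_bijective [FiniteDimensional ℝ E] [FiniteDimensional ℝ V]
    (hd : Module.finrank ℝ V = Module.finrank ℝ E + 1) {L : E →L[ℝ] V} {w : V} :
    Transverse L w ↔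
      w ≠ 0 ∧ Function.Bijective fun v : E => (Submodule.span ℝ {w}).mkQ (L v) := by
  let Q : E →ₗ[ℝ] V ⧸ Submodule.span ℝ {w} := (Submodule.span ℝ {w}).mkQ ∘ₗ L.toLinearMap
  constructor
  · intro h
    refine ⟨h.ne_zero, ?_⟩
    have hinj : Function.Injective Q := by
      rw [injective_iff_map_eq_zero]
      intro v hv
      obtain ⟨c, hc⟩ := Submodule.mem_span_singleton.1 ((Submodule.Quotient.mk_eq_zero _).1 hv)
      exact (h v (-c) (by rw [neg_smul, hc]; simp)).1
    have hq := Submodule.finrank_quotient_add_finrank (Submodule.span ℝ {w})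
    rw [finrank_span_singleton h.ne_zero, hd] at hq
    exact ⟨hinj, (LinearMap.injective_iff_surjective_of_finrank_eq_finrank
      (by omega : Module.finrank ℝ E = _)).1 hinj⟩
  · rintro ⟨hw, hb⟩ v c hv
    have hinj : Function.Injective Q := hb.1
    have hv0 : v = 0 := by
      refine (injective_iff_map_eq_zero Q).1 hinj v ((Submodule.Quotient.mk_eq_zero _).2 ?_)
      refine Submodule.mem_span_singleton.2 ⟨-c, ?_⟩
      rw [neg_smul]
      exact (eq_neg_of_add_eq_zero_left hv).symm
    refine ⟨hv0, ?_⟩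
    simpa [hv0, hw] using hv

/-- Transversality is injectivity of `(v, c) ↦ L v + c • w` on `E × ℝ`, an open condition in finite
dimension. -/
theorem isOpen_transverse [FiniteDimensional ℝ E] :
    IsOpen {q : (E →L[ℝ] V) × V | Transverse q.1 q.2} := by
  let Φ : (E →L[ℝ] V) × V → (E × ℝ →L[ℝ] V) := fun q =>
    q.1 ∘L ContinuousLinearMap.fst ℝ E ℝ
      + (ContinuousLinearMap.snd ℝ E ℝ).smulRight q.2
  have hΦ : Continuous Φ := by
    refine Continuous.add ?_ ?_
    · exact continuous_fst.clm_comp continuous_const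
    · exact ((ContinuousLinearMap.smulRightL ℝ (E × ℝ) V
        (ContinuousLinearMap.snd ℝ E ℝ)).continuous).comp continuous_snd
  convert ContinuousLinearMap.isOpen_injective.preimage hΦ using 1
  ext q
  simp only [mem_ofPred_eq, mem_preimage, injective_iff_map_eq_zero, Prod.forall, Transverse]
  simp [Φ, Prod.mk_eq_zero]

variable {H N H' N' : Type*} [TopologicalSpace H] {I : ModelWithCorners ℝ E H}
  [TopologicalSpace N] [ChartedSpace H N]
  {E' : Type*} [NormedAddCommGroup E'] [NormedSpace ℝ E'] [TopologicalSpace H']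
  {I' : ModelWithCorners ℝ E' H'} [TopologicalSpace N'] [ChartedSpace H' N']

variable (I) in
/-- The differential at `x` of a map to a vector space. -/
def vderiv (f : N → V) (x : N) : E →L[ℝ] V := mfderiv I 𝓘(ℝ, V) f x

theorem vderiv_eq {f : N → V} {x : N} {L : E →L[ℝ] V} (h : HasMFDerivAt I 𝓘(ℝ, V) f x L) :
    vderiv I f x = L := h.mfderiv

theorem hasMFDerivAt_vderiv {f : N → V} {x : N} (h : MDifferentiableAt I 𝓘(ℝ, V) f x) :
    HasMFDerivAt I 𝓘(ℝ, V) f x (vderiv (E := E) (V := V) I f x) := h.hasMFDerivAt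

variable (I) in
/-- The map to projective space defined by `f` is an immersion at `x`. -/
def TransverseAt (f : N → V) (x : N) : Prop :=
  Transverse (vderiv I f x) (f x)

theorem TransverseAt.congr {f g : N → V} {x : N} (h : TransverseAt I f x) (hfg : g =ᶠ[𝓝 x] f) :
    TransverseAt I g x := by
  have hd : vderiv I g x = vderiv I f x := hfg.mfderiv_eq
  rw [TransverseAt, hd, hfg.eq_of_nhds]
  exact h

theorem TransverseAt.comp {f : N' → V} {g : N → N'} {x : N} (h : TransverseAt I' f (g x))
    (hf : MDifferentiableAt I' 𝓘(ℝ, V) f (g x)) (hg : MDifferentiableAt I I' g x)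
    (hinj : Function.Injective (mfderiv I I' g x)) : TransverseAt I (f ∘ g) x := by
  intro v c hv
  have hd := vderiv_eq (hf.hasMFDerivAt.comp x hg.hasMFDerivAt)
  rw [hd] at hv
  obtain ⟨h1, h2⟩ := h (mfderiv I I' g x v) c hv
  exact ⟨(injective_iff_map_eq_zero (mfderiv I I' g x)).1 hinj v h1, h2⟩

theorem vderiv_clm_comp {f : N → V} {x : N} (hf : MDifferentiableAt I 𝓘(ℝ, V) f x)
    (A : V →L[ℝ] V') : vderiv I (fun y => A (f y)) x = A ∘L vderiv I f x :=
  vderiv_eq (A.hasMFDerivAt.comp x (hasMFDerivAt_vderiv hf))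

theorem TransverseAt.clm_comp {f : N → V} {x : N} (h : TransverseAt I f x)
    (hf : MDifferentiableAt I 𝓘(ℝ, V) f x) {A : V →L[ℝ] V'} (hA : Function.Injective A) :
    TransverseAt I (fun y => A (f y)) x := by
  intro v c hv
  rw [vderiv_clm_comp hf] at hv
  refine h v c ((injective_iff_map_eq_zero A).1 hA _ ?_)
  rw [map_add, map_smul]
  exact hv

theorem vderiv_smul {f : N → V} {φ : N → ℝ} {x : N}
    (hf : MDifferentiableAt I 𝓘(ℝ, V) f x) (hφ : MDifferentiableAt I 𝓘(ℝ, ℝ) φ x) :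
    vderiv I (fun y => φ y • f y) x =
      φ x • vderiv I f x + (vderiv I φ x).smulRight (f x) := by
  refine vderiv_eq ⟨hφ.continuousAt.smul hf.continuousAt, ?_⟩
  have h1 : HasFDerivWithinAt (φ ∘ (extChartAt I x).symm) (vderiv I φ x) (range I)
    (extChartAt I x x) := hφ.hasMFDerivAt.2
  have h2 : HasFDerivWithinAt (f ∘ (extChartAt I x).symm) (vderiv I f x) (range I)
    (extChartAt I x x) := hf.hasMFDerivAt.2
  have h3 := h1.smul h2
  simp only [Function.comp_apply, extChartAt_to_inv] at h3
  exact h3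

/-- The derivatives of `φ • f` and of `f` scaled by `φ x` differ by a multiple of `f x`, which is
invisible modulo the line. -/
theorem TransverseAt.smul {f : N → V} {φ : N → ℝ} {x : N} (h : TransverseAt I f x)
    (hf : MDifferentiableAt I 𝓘(ℝ, V) f x) (hφ : MDifferentiableAt I 𝓘(ℝ, ℝ) φ x)
    (h0 : φ x ≠ 0) : TransverseAt I (fun y => φ y • f y) x := by
  intro v c hv
  rw [vderiv_smul hf hφ] at hv
  have h1 := h (φ x • v) (vderiv I φ x v + c * φ x) (by
    rw [← hv, map_smul]
    simp only [add_apply, smul_apply, ContinuousLinearMap.smulRight_apply, add_smul, mul_smul,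
      add_assoc])
  have hv0 : v = 0 := (smul_eq_zero.1 h1.1).resolve_left h0
  refine ⟨hv0, ?_⟩
  simpa [hv0, h0] using h1.2

theorem vderiv_sum {ι : Type*} (S : Finset ι) {f : ι → N → V} {x : N}
    (hf : ∀ i, MDifferentiableAt I 𝓘(ℝ, V) (f i) x) :
    vderiv I (fun y => ∑ i ∈ S, f i y) x = ∑ i ∈ S, vderiv I (f i) x := by
  classical
  refine vderiv_eq ?_
  induction S using Finset.induction_on with
  | empty => simpa using! hasMFDerivAt_const (0 : V) x
  | insert i s hi IH =>
    rw [Finset.sum_insert hi]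
    exact (HasMFDerivAt.add (hasMFDerivAt_vderiv (hf i)) IH).congr_of_eventuallyEq
      (Eventually.of_forall fun y => Finset.sum_insert hi)

end Transverse

/-! ### Openness of the immersion condition -/

section Families

variable {E V V' : Type*} [NormedAddCommGroup E] [NormedSpace ℝ E] [FiniteDimensional ℝ E]
  [NormedAddCommGroup V] [NormedSpace ℝ V] [NormedAddCommGroup V'] [NormedSpace ℝ V']
  {H N : Type*} [TopologicalSpace H] {I : ModelWithCorners ℝ E H}
  [TopologicalSpace N] [ChartedSpace H N] [IsManifold I 1 N]

/-- Being an immersion is an open condition in finite linear families. -/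
theorem eventually_transverseAt_sum {ι : Type*} (S : Finset ι) {h : ι → N → V}
    (hh : ∀ i, ContMDiff I 𝓘(ℝ, V) 1 (h i)) {a₀ : ι → V →L[ℝ] V'} {y₀ : N}
    (ht : TransverseAt I (fun y => ∑ i ∈ S, a₀ i (h i y)) y₀) :
    ∀ᶠ z : (ι → V →L[ℝ] V') × N in 𝓝 (a₀, y₀),
      TransverseAt I (fun y => ∑ i ∈ S, z.1 i (h i y)) z.2 := by
  -- The derivative of `h i` read in the chart at `y₀`: all its values lie in one fixed space, where
  -- continuity in the point makes sense. The bijections `e y` translate back.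
  let T : ι → N → E →L[ℝ] V := fun i =>
    inTangentCoordinates I 𝓘(ℝ, V) id (h i) (mfderiv I 𝓘(ℝ, V) (h i)) y₀
  let e : N → E →L[ℝ] E := fun y =>
    mfderivWithin 𝓘(ℝ, E) I (extChartAt I y₀).symm (range I) (extChartAt I y₀ y)
  have hT : ∀ i, ContinuousAt (T i) y₀ := fun i =>
    (((hh i) y₀).mfderiv_const (m := 0) (by simp)).continuousAt
  have hTe : ∀ i, ∀ y ∈ (chartAt H y₀).source, ∀ u,
      T i y u = vderiv I (h i) y (e y u) := by
    intro i y hy u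
    have := inTangentCoordinates_eq_mfderiv_comp (I := I) (I' := 𝓘(ℝ, V)) (f := id) (g := h i)
      (ϕ := mfderiv I 𝓘(ℝ, V) (h i)) (x₀ := y₀) (x := y) hy (mem_univ _)
    have hid : mfderiv 𝓘(ℝ, V) 𝓘(ℝ, V) (extChartAt 𝓘(ℝ, V) (h i y₀)) (h i y) =
        ContinuousLinearMap.id ℝ V := by
      rw [extChartAt_model_space_eq_id]
      exact mfderiv_id
    rw [hid] at this
    change inTangentCoordinates I 𝓘(ℝ, V) id (h i) (mfderiv I 𝓘(ℝ, V) (h i)) y₀ y u = _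
    rw [this]
    rfl
  have hsum : ∀ (a : ι → V →L[ℝ] V') (y : N) (v : E),
      vderiv I (fun y => ∑ i ∈ S, a i (h i y)) y v =
        ∑ i ∈ S, a i (vderiv I (h i) y v) := by
    intro a y v
    have hm : ∀ i, MDifferentiableAt I 𝓘(ℝ, V) (h i) y := fun i =>
      (hh i).mdifferentiable one_ne_zero y
    have hc : ∀ i, MDifferentiableAt I 𝓘(ℝ, V') (fun y => a i (h i y)) y := fun i =>
      (a i).differentiableAt.mdifferentiableAt.comp y (hm i)
    rw [vderiv_sum S hc]
    simp only [sum_apply]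
    refine Finset.sum_congr rfl fun i _ => ?_
    exact DFunLike.congr_fun (vderiv_clm_comp (hm i) (a i)) v
  have he : ∀ y ∈ (chartAt H y₀).source, Function.Bijective (e y) := by
    intro y hy
    exact (isInvertible_mfderivWithin_extChartAt_symm
      ((extChartAt I y₀).map_source (by rwa [extChartAt_source]))).bijective
  let Ψ : (ι → V →L[ℝ] V') × N → (E →L[ℝ] V') × V' := fun z =>
    (∑ i ∈ S, (z.1 i) ∘L (T i z.2), ∑ i ∈ S, z.1 i (h i z.2))
  have hΨ : ContinuousAt Ψ (a₀, y₀) := by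
    have ha : ∀ i, ContinuousAt (fun z : (ι → V →L[ℝ] V') × N => z.1 i) (a₀, y₀) := fun i =>
      ((continuous_apply i).comp continuous_fst).continuousAt
    refine ContinuousAt.prodMk ?_ ?_
    · refine tendsto_finsetSum _ fun i _ => ?_
      exact (ha i).clm_comp (ContinuousAt.comp (g := T i) (hT i) continuousAt_snd)
    · refine tendsto_finsetSum _ fun i _ => ?_
      exact (ha i).clm_apply (((hh i).continuous.comp continuous_snd).continuousAt)
  have hΨ₀ : Transverse (Ψ (a₀, y₀)).1 (Ψ (a₀, y₀)).2 := by
    intro u c hu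
    have hy := mem_chart_source H y₀
    have h1 := ht (e y₀ u) c (by
      rw [hsum]
      simpa [Ψ, hTe _ _ hy] using hu)
    exact ⟨(injective_iff_map_eq_zero (e y₀)).1 (he y₀ hy).1 u h1.1, h1.2⟩
  have hsrc : ∀ᶠ z : (ι → V →L[ℝ] V') × N in 𝓝 (a₀, y₀), z.2 ∈ (chartAt H y₀).source :=
    continuousAt_snd.eventually (chart_source_mem_nhds H y₀)
  filter_upwards [hΨ.eventually (isOpen_transverse.mem_nhds hΨ₀), hsrc] with z hz hzs v c hv
  obtain ⟨u, rfl⟩ := (he z.2 hzs).2 v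
  rw [hsum] at hv
  have h1 := hz u c (by simpa [Ψ, hTe _ _ hzs] using hv)
  exact ⟨by rw [h1.1, map_zero], h1.2⟩

end Families

/-! ### Deck transformations -/

section Deck

variable {N M : Type*} [TopologicalSpace N]

/-- The group of deck transformations of `p`. -/
def deck (p : N → M) : Subgroup (N ≃ₜ N) where
  carrier := {φ | ∀ y, p (φ y) = p y}
  one_mem' _ := rfl
  mul_mem' {φ ψ} hφ hψ y := (hφ (ψ y)).trans (hψ y)
  inv_mem' {φ} hφ y := by
    have h : φ (φ⁻¹ y) = y := φ.apply_symm_apply y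
    rw [← hφ (φ⁻¹ y), h]

instance (p : N → M) : MulAction (deck p) N where
  smul φ y := (φ : N ≃ₜ N) y
  one_smul _ := rfl
  mul_smul _ _ _ := rfl

theorem proj_deck_smul {p : N → M} (φ : deck p) (y : N) : p (φ • y) = p y := φ.2 y

theorem continuous_deck_smul {p : N → M} (φ : deck p) : Continuous fun y : N => φ • y :=
  (φ : N ≃ₜ N).continuous

variable [TopologicalSpace M] {p : N → M}

theorem deck_ext [PreconnectedSpace N] (hp : IsCoveringMap p) {φ ψ : deck p} {y : N}
    (h : φ • y = ψ • y) : φ = ψ := by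
  refine Subtype.ext (Homeomorph.ext fun z => ?_)
  have := hp.eq_of_comp_eq (continuous_deck_smul φ) (continuous_deck_smul ψ)
    (funext fun z => (proj_deck_smul φ z).trans (proj_deck_smul ψ z).symm) y h
  exact congrFun this z

/-- Lift `p` through itself, once with `y ↦ z` and once with `z ↦ y`; uniqueness of lifts makes the
two maps inverse to each other. -/
theorem exists_deck_smul_eq [SimplyConnectedSpace N] [LocallyPathConnectedSpace N]
    (hp : IsCoveringMap p) {y z : N} (h : p y = p z) : ∃ φ : deck p, φ • y = z := by
  let P : C(N, M) := ⟨p, hp.continuous⟩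
  obtain ⟨f, ⟨hf, hpf⟩, -⟩ := hp.existsUnique_continuousMap_lifts P y z h.symm
  obtain ⟨g, ⟨hg, hpg⟩, -⟩ := hp.existsUnique_continuousMap_lifts P z y h
  have hpf' : ∀ w, p (f w) = p w := congrFun hpf
  have hpg' : ∀ w, p (g w) = p w := congrFun hpg
  have hgf : g ∘ f = id := hp.eq_of_comp_eq (g.continuous.comp f.continuous) continuous_id
    (funext fun w => (hpg' _).trans (hpf' _)) y (by simp [hf, hg])
  have hfg : f ∘ g = id := hp.eq_of_comp_eq (f.continuous.comp g.continuous) continuous_id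
    (funext fun w => (hpf' _).trans (hpg' _)) z (by simp [hf, hg])
  exact ⟨⟨⟨⟨f, g, congrFun hgf, congrFun hfg⟩, f.continuous, g.continuous⟩, hpf'⟩, hf⟩

theorem exists_nhds_deck_subsingleton [PreconnectedSpace N] [LocallyConnectedSpace N] [T2Space M]
    (hp : IsCoveringMap p) (x y : N) :
    ∃ U ∈ 𝓝 x, ∃ V ∈ 𝓝 y, {φ : deck p | ∃ u ∈ U, φ • u ∈ V}.Subsingleton := by
  by_cases hxy : p x = p y
  · obtain ⟨e, hy, rfl⟩ := hp.isLocalHomeomorph y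
    have hx : e x ∈ e.target := hxy ▸ e.map_source hy
    have hW : e ⁻¹' e.target ∈ 𝓝 x :=
      hp.continuous.continuousAt.preimage_mem_nhds (e.open_target.mem_nhds hx)
    obtain ⟨U, hU, hUc, hUW⟩ := locallyConnectedSpace_iff_connected_subsets.1 ‹_› x _ hW
    refine ⟨U, hU, e.source, e.open_source.mem_nhds hy, ?_⟩
    -- On the connected set `U`, both `φ` and the local section `e.symm ∘ e` lift `e`. Agreeing at
    -- `u` they agree at `x`, so `φ • x` is the same for every such `φ`.
    have key : ∀ φ : deck e, (∃ u ∈ U, φ • u ∈ e.source) → φ • x = e.symm (e x) := by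
      rintro φ ⟨u, hu, huV⟩
      have hq : ContinuousOn (fun w => e.symm (e w)) U :=
        e.continuousOn_symm.comp hp.continuous.continuousOn hUW
      refine hp.eqOn_of_comp_eqOn hUc (continuous_deck_smul φ).continuousOn hq ?_ hu ?_
        (mem_of_mem_nhds hU)
      · intro w hw
        simp only [Function.comp_apply]
        rw [proj_deck_smul (p := e), e.right_inv (hUW hw)]
      · rw [← proj_deck_smul (p := e) φ u, e.left_inv huV]
    intro φ hφ ψ hψ
    exact deck_ext hp ((key φ hφ).trans (key ψ hψ).symm)
  · obtain ⟨A, B, hA, hB, hxA, hyB, hAB⟩ := t2_separation hxy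
    refine ⟨p ⁻¹' A, (hA.preimage hp.continuous).mem_nhds hxA, p ⁻¹' B,
      (hB.preimage hp.continuous).mem_nhds hyB, ?_⟩
    rintro φ ⟨u, hu, hu'⟩
    rw [mem_preimage, proj_deck_smul (p := p)] at hu'
    exact absurd hu' (disjoint_left.1 hAB hu)

/-- Deck transformations act properly discontinuously. -/
theorem finite_deck_of_isCompact [PreconnectedSpace N] [LocallyConnectedSpace N] [T2Space M]
    (hp : IsCoveringMap p) {K L : Set N} (hK : IsCompact K) (hL : IsCompact L) :
    {φ : deck p | ∃ u ∈ K, φ • u ∈ L}.Finite := by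
  have hKL := hK.prod hL
  choose U hU V hV hUV using exists_nhds_deck_subsingleton hp
  obtain ⟨T, -, hT⟩ := hKL.elim_nhds_subcover (fun q => U q.1 q.2 ×ˢ V q.1 q.2)
    fun q _ => prod_mem_nhds (hU q.1 q.2) (hV q.1 q.2)
  refine (T.finite_toSet.biUnion fun q _ => (hUV q.1 q.2).finite).subset ?_
  rintro φ ⟨u, hu, hφu⟩
  obtain ⟨q, hq, h1, h2⟩ := mem_iUnion₂.1 (hT (mk_mem_prod hu hφu))
  exact mem_biUnion hq ⟨u, h1, h2⟩

end Deck

/-! ### The homomorphism from deck transformations to the fundamental group -/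

section DeckClass

variable {N M : Type*} [TopologicalSpace N] [TopologicalSpace M] {p : N → M}

theorem deckClass_eq [SimplyConnectedSpace N] (hp : Continuous p) {x₀ : M} {y₀ : N}
    (hy₀ : p y₀ = x₀) (φ : N ≃ₜ N) (hφ : ∀ y, p (φ y) = p y) (c c' : Path (φ y₀) y₀) :
    deckClass hp hy₀ φ hφ c = deckClass hp hy₀ φ hφ c' := by
  unfold deckClass
  congr 1
  exact Path.Homotopic.Quotient.eq.2
    (((SimplyConnectedSpace.paths_homotopic c c').map ⟨p, hp⟩).pathCast _ _)

/-- Run from `φ ψ y₀` to `φ y₀` along the translate of `d`, then to `y₀` along `c`; the translate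
has the same projection as `d`. -/
theorem deckClass_mul (hp : Continuous p) {x₀ : M} {y₀ : N} (hy₀ : p y₀ = x₀)
    (φ ψ : deck p) (c : Path ((φ : N ≃ₜ N) y₀) y₀) (d : Path ((ψ : N ≃ₜ N) y₀) y₀) :
    deckClass hp hy₀ (φ * ψ : deck p) (φ * ψ).2
        (((d.map (φ : N ≃ₜ N).continuous)).trans c) =
      deckClass hp hy₀ φ φ.2 c * deckClass hp hy₀ ψ ψ.2 d := by
  rw [FundamentalGroup.mul_def]
  unfold deckClass
  change _ = Path.Homotopic.Quotient.trans (Path.Homotopic.Quotient.mk _)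
    (Path.Homotopic.Quotient.mk _)
  rw [← Path.Homotopic.Quotient.mk_trans]
  change Path.Homotopic.Quotient.mk _ = _
  congr 1
  ext t
  change p (((d.map (φ : N ≃ₜ N).continuous).trans c) t) = _
  simp only [Path.cast_coe, Path.map_coe, Function.comp_apply, Path.trans_apply]
  split_ifs
  · exact φ.2 _
  · rfl

/-- The class in the fundamental group of a deck transformation of a simply connected cover. -/
def deckHom [SimplyConnectedSpace N] (hp : Continuous p) {x₀ : M} {y₀ : N} (hy₀ : p y₀ = x₀) :
    deck p →* FundamentalGroup M x₀ :=
  MonoidHom.mk' (fun φ => deckClass hp hy₀ φ φ.2 (PathConnectedSpace.somePath _ _)) fun φ ψ => by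
    rw [← deckClass_mul]
    exact deckClass_eq hp hy₀ _ _ _ _

theorem deckHom_eq [SimplyConnectedSpace N] (hp : Continuous p) {x₀ : M} {y₀ : N}
    (hy₀ : p y₀ = x₀) (φ : deck p) (c : Path ((φ : N ≃ₜ N) y₀) y₀) :
    deckHom hp hy₀ φ = deckClass hp hy₀ φ φ.2 c :=
  deckClass_eq hp hy₀ _ _ _ _

variable {N' M' : Type*} [TopologicalSpace N'] [TopologicalSpace M'] {p' : N' → M'}

/-- A map of covers that intertwines two deck transformations maps the class of the one to the
class of the other. -/
theorem map_deckClass (hp : Continuous p) (hp' : Continuous p') (f : C(M, M')) {F : N → N'}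
    (hF : Continuous F) (hpF : ∀ z, p' (F z) = f (p z)) {x₀ : M} {y₀ : N} (hy₀ : p y₀ = x₀)
    {y : N'} (hy : p' y = f x₀) (hFy : F y₀ = y) (φ : deck p) (φ' : deck p')
    (hφ : ∀ z, F (φ • z) = φ' • F z) (c : Path ((φ : N ≃ₜ N) y₀) y₀) :
    ∃ c' : Path ((φ' : N' ≃ₜ N') y) y,
      FundamentalGroup.map f x₀ (deckClass hp hy₀ φ φ.2 c) = deckClass hp' hy φ' φ'.2 c' := by
  subst hFy
  refine ⟨(c.map hF).cast (hφ y₀).symm rfl, ?_⟩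
  unfold deckClass
  change Path.Homotopic.Quotient.map (Path.Homotopic.Quotient.mk _) f =
    Path.Homotopic.Quotient.mk _
  rw [← Path.Homotopic.Quotient.mk_map]
  congr 1
  ext t
  simp [hpF]

end DeckClass

/-! ### Smooth maps between covers -/

section SmoothLifts

variable {E H N M E₀ H₀ N₀ : Type*} [NormedAddCommGroup E] [NormedSpace ℝ E] [TopologicalSpace H]
  {I : ModelWithCorners ℝ E H} [TopologicalSpace N] [ChartedSpace H N]
  [TopologicalSpace M] [ChartedSpace H M]
  [NormedAddCommGroup E₀] [NormedSpace ℝ E₀] [TopologicalSpace H₀]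
  {I₀ : ModelWithCorners ℝ E₀ H₀} [TopologicalSpace N₀] [ChartedSpace H₀ N₀]

theorem contMDiff_of_comp_isLocalDiffeomorph {p : N → M} (hp : IsLocalDiffeomorph I I ∞ p)
    {g : N₀ → N} (hg : Continuous g) (hpg : ContMDiff I₀ I ∞ (p ∘ g)) : ContMDiff I₀ I ∞ g := by
  intro x
  obtain ⟨Φ, hx, hΦ⟩ := hp (g x)
  have hsymm : ContMDiffAt I I ∞ Φ.symm (p (g x)) := by
    refine Φ.symm.contMDiffOn.contMDiffAt (Φ.open_target.mem_nhds ?_)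
    rw [hΦ hx]
    exact Φ.map_source hx
  have hcomp : ContMDiffAt I₀ I ∞ (Φ.symm ∘ (p ∘ g)) x := hsymm.comp x (hpg x)
  refine hcomp.congr_of_eventuallyEq ?_
  filter_upwards [hg.continuousAt.preimage_mem_nhds (Φ.open_source.mem_nhds hx)] with y hy
  simp only [Function.comp_apply]
  rw [hΦ hy]
  exact (Φ.left_inv hy).symm

theorem injective_mfderiv_of_comp {p : N → M} {g : N₀ → N} {x : N₀}
    (hp : MDifferentiableAt I I p (g x)) (hg : MDifferentiableAt I₀ I g x)
    (h : Function.Injective (mfderiv I₀ I (p ∘ g) x)) :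
    Function.Injective (mfderiv I₀ I g x) := by
  rw [mfderiv_comp x hp hg] at h
  exact Function.Injective.of_comp h

theorem IsUniversalCover.contMDiff_smul {p : N → M} (hp : IsUniversalCover I p) (φ : deck p) :
    ContMDiff I I ∞ fun y : N => φ • y := by
  refine contMDiff_of_comp_isLocalDiffeomorph hp.isLocalDiffeomorph (continuous_deck_smul φ) ?_
  have h : p ∘ (fun y : N => φ • y) = p := funext (proj_deck_smul φ)
  rw [h]
  exact hp.isLocalDiffeomorph.contMDiff

theorem IsUniversalCover.injective_mfderiv_smul {p : N → M} (hp : IsUniversalCover I p)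
    (φ : deck p) (x : N) : Function.Injective (mfderiv I I (fun y : N => φ • y) x) := by
  refine injective_mfderiv_of_comp (p := p) (hp.isLocalDiffeomorph.mdifferentiable (by simp) _)
    ((hp.contMDiff_smul φ).mdifferentiable (by simp) x) ?_
  have h : p ∘ (fun y : N => φ • y) = p := funext (proj_deck_smul φ)
  rw [h]
  exact (hp.isLocalDiffeomorph.mfderivToContinuousLinearEquiv (by simp) x).injective

theorem IsUniversalCover.t2Space {p : N → M} [T2Space M] (hp : IsUniversalCover I p) :
    T2Space N := by
  refine ⟨fun x y hxy => ?_⟩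
  by_cases h : p x = p y
  · exact hp.isCoveringMap.isSeparatedMap x y h hxy
  · obtain ⟨A, B, hA, hB, hxA, hyB, hAB⟩ := t2_separation h
    have hc := hp.isCoveringMap.continuous
    exact ⟨p ⁻¹' A, p ⁻¹' B, hA.preimage hc, hB.preimage hc, hxA, hyB, hAB.preimage p⟩

/-- A cocompact smooth bump function on the universal cover of a compact manifold. -/
theorem IsUniversalCover.exists_bump {p : N → M} [FiniteDimensional ℝ E] [T2Space M]
    [CompactSpace M] [LocallyPathConnectedSpace H] [IsManifold I ∞ N]
    (hp : IsUniversalCover I p) :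
    ∃ χ : N → ℝ, ContMDiff I 𝓘(ℝ, ℝ) ∞ χ ∧ (∀ x, 0 ≤ χ x) ∧ HasCompactSupport χ ∧
      ∀ x, ∃ φ : deck p, χ (φ⁻¹ • x) ≠ 0 := by
  have := hp.t2Space
  have := hp.simplyConnectedSpace
  have := ChartedSpace.locallyPathConnectedSpace H N
  let f : ∀ c : N, SmoothBumpFunction I c := fun c => Classical.arbitrary _
  choose s hs using hp.surjective
  -- Finitely many bump supports project onto all of `M`, so every point of the cover is a deck
  -- translate of a point in one of them.
  obtain ⟨T, hT⟩ := isCompact_univ.elim_nhds_subcover (fun x : M => p '' Function.support (f (s x)))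
    fun x _ => by
      have := hp.isCoveringMap.isOpenMap.image_mem_nhds ((f (s x)).support_mem_nhds)
      rwa [hs] at this
  refine ⟨fun y => ∑ x ∈ T, f (s x) y, ?_, ?_, ?_, ?_⟩
  · exact contMDiff_finsetSum fun x _ => (f (s x)).contMDiff
  · exact fun y => Finset.sum_nonneg fun x _ => (f (s x)).nonneg
  · refine HasCompactSupport.intro (K := ⋃ x ∈ T, tsupport (f (s x)))
      (T.isCompact_biUnion fun x _ => (f (s x)).hasCompactSupport) fun y hy => ?_
    refine Finset.sum_eq_zero fun x hx => ?_
    by_contra h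
    exact hy (mem_biUnion hx (subset_tsupport _ h))
  · intro y
    obtain ⟨x, hx, z, hz, hzy⟩ := mem_iUnion₂.1 (hT.2 (mem_univ (p y)))
    obtain ⟨φ, hφ⟩ := exists_deck_smul_eq hp.isCoveringMap hzy
    refine ⟨φ, ?_⟩
    rw [← hφ, inv_smul_smul]
    exact (Finset.sum_pos' (fun x _ => (f (s x)).nonneg)
      ⟨x, hx, (f (s x)).nonneg.lt_of_ne' hz⟩).ne'

end SmoothLifts

/-! ### The affine lift of a half-pipe developing map -/

section AffineLift

variable {n : ℕ} {E H N : Type*} [NormedAddCommGroup E] [NormedSpace ℝ E]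
  [FiniteDimensional ℝ E] [TopologicalSpace H] {I : ModelWithCorners ℝ E H}
  [TopologicalSpace N] [ChartedSpace H N]

theorem transverseAt_iff (hE : Module.finrank ℝ E = n) {f : N → Vec n} {x : N} :
    TransverseAt I f x ↔ f x ≠ 0 ∧ Function.Bijective fun v : TangentSpace I x =>
      (Submodule.span ℝ {f x}).mkQ (mfderiv I 𝓘(ℝ, Vec n) f x v : Vec n) :=
  transverse_iff_bijective (by simp [hE])

/-- Dividing a smooth local lift by its timelike coordinate, nonzero on half-pipe space, removes its
ambiguity, so the local lifts fit into one global lift. -/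
theorem contMDiffAt_and_transverseAt_affineRep [NeZero n] (hE : Module.finrank ℝ E = n) {D : N → RP n}
    (hD : IsProjLocalDiffeo I D) (hX : ∀ x, D x ∈ X n 0) (x : N) :
    ContMDiffAt I 𝓘(ℝ, Vec n) ∞ (fun y => affineRep (D y)) x ∧
      TransverseAt I (fun y => affineRep (D y)) x := by
  obtain ⟨f, U, hU, hf, hl, hb⟩ := hD x
  rw [isLiftOn_iff] at hl
  have hc : ∀ y ∈ U, f y (i₀ n) ≠ 0 := fun y hy => by
    refine coord_ne_zero ((toRP_mem_X (hl y hy).1).1 ?_)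
    rw [(hl y hy).2]
    exact hX y
  have heq : (fun y => affineRep (D y)) =ᶠ[𝓝 x] fun y => (f y (i₀ n))⁻¹ • f y := by
    filter_upwards [hU] with y hy
    rw [← (hl y hy).2, affineRep_eq (hl y hy).1]
  have hxU := mem_of_mem_nhds hU
  have hfx : ContMDiffAt I 𝓘(ℝ, Vec n) ∞ f x := hf.contMDiffAt hU
  have hφ : ContMDiffAt I 𝓘(ℝ, ℝ) ∞ (fun y => (f y (i₀ n))⁻¹) x :=
    ContMDiffAt.inv₀ (contMDiffAt_pi_space.1 hfx (i₀ n)) (hc x hxU)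
  refine ⟨(hφ.smul hfx).congr_of_eventuallyEq heq, TransverseAt.congr ?_ heq⟩
  exact ((transverseAt_iff hE).2 ⟨(hl x hxU).1, hb⟩).smul (hfx.mdifferentiableAt (by simp))
    (hφ.mdifferentiableAt (by simp)) (inv_ne_zero (hc x hxU))

end AffineLift

/-! ### Rescaling -/

section Rescaling

variable {n : ℕ}

/-- The matrix `diag(1, …, 1, c)`. -/
def lastDiag (n : ℕ) (c : ℝ) : Mat n := Matrix.diagonal (Sum.elim (fun _ => 1) fun _ => c)

theorem fromBlocks_eq_lastDiag (c : ℝ) :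
    (Matrix.fromBlocks 1 0 0 (c • 1) : Mat n) = lastDiag n c := by
  rw [lastDiag, ← Matrix.fromBlocks_diagonal, Matrix.smul_one_eq_diagonal, Matrix.diagonal_one]

theorem exists_mk_eq_resc (n : ℕ) {t : ℝ} (ht : t ≠ 0) :
    ∃ R : GLGroup n, Matrix.ProjGenLinGroup.mk R = resc n t ∧
      (R : Mat n) = lastDiag n |t|⁻¹ ∧ ((R⁻¹ : GLGroup n) : Mat n) = lastDiag n |t| := by
  rw [resc, dif_neg ht]
  exact ⟨_, rfl, fromBlocks_eq_lastDiag _, fromBlocks_eq_lastDiag _⟩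

theorem resc_inv_smul_toRP {t : ℝ} (ht : t ≠ 0) {w : Vec n} (hw : w ≠ 0) :
    (resc n t)⁻¹ • toRP w = toRP (lastDiag n |t| *ᵥ w) ∧ lastDiag n |t| *ᵥ w ≠ 0 := by
  obtain ⟨R, hR, -, hR'⟩ := exists_mk_eq_resc n ht
  rw [← hR, ← map_inv, mk_smul_toRP _ hw, ← hR']
  exact ⟨rfl, GL_mulVec_ne_zero _ hw⟩

/-- The last coefficient becomes `sign(s) t ^ 2`, which belongs to `η_t` because `s` and `t` have
the same sign. Here the sign of the time selects the geometry. -/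
theorem eta_lastDiag_mulVec {s t : ℝ} (hs : s = 1 ∨ s = -1) (hst : 0 < s * t) (w : Vec n) :
    (lastDiag n |t| *ᵥ w) ⬝ᵥ (eta n s *ᵥ (lastDiag n |t| *ᵥ w)) = w ⬝ᵥ (eta n t *ᵥ w) := by
  simp only [dotProduct_eta_mulVec, sign_mul_sq, lastDiag, Matrix.mulVec_diagonal, Sum.elim_inl,
    Sum.elim_inr, one_mul]
  congr 1
  rcases hs with rfl | rfl
  · rw [one_mul] at hst
    rw [abs_of_pos hst]
    simp
    ring
  · have ht : t < 0 := by linarith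
    rw [abs_of_neg ht]
    simp
    ring

theorem contDiffOn_lastDiag {k : ℕ∞} {φ : ℝ → ℝ} {U : Set ℝ} (hφ : ContDiffOn ℝ k φ U)
    (i : Fin n ⊕ Unit) :
    ContDiffOn ℝ k (fun u => Sum.elim (fun _ : Fin n => (1 : ℝ)) (fun _ : Unit => φ u) i) U := by
  rcases i with i | i
  · exact contDiffOn_const
  · exact hφ

theorem contDiffOn_abs_of_ne {k : ℕ∞} {U : Set ℝ} (hU : ∀ u ∈ U, u ≠ 0) :
    ContDiffOn ℝ k (fun u : ℝ => |u|) U := fun u hu =>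
  (contDiffAt_abs (hU u hu)).contDiffWithinAt

/-- Conjugation by the rescaling maps preserves the regularity of paths. -/
theorem PathContDiffOn.conj_resc {k : ℕ∞} {g : ℝ → PGL n} {S : Set ℝ} (hS : ∀ u ∈ S, u ≠ 0)
    (hSo : IsOpen S) (hg : PathContDiffOn k g S) :
    PathContDiffOn k (fun u => resc n u * g u * (resc n u)⁻¹) S := by
  intro t ht
  obtain ⟨B, U, hU, hB, hBg⟩ := hg t ht
  have hR : ∀ u : ℝ, ∃ R : GLGroup n, u ≠ 0 → Matrix.ProjGenLinGroup.mk R = resc n u ∧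
      (R : Mat n) = lastDiag n |u|⁻¹ ∧ ((R⁻¹ : GLGroup n) : Mat n) = lastDiag n |u| := by
    intro u
    by_cases hu : u = 0
    -- An arbitrary value at time 0, which is not in `S`.
    · exact ⟨1, fun h => absurd hu h⟩
    · obtain ⟨R, h⟩ := exists_mk_eq_resc n hu
      exact ⟨R, fun _ => h⟩
  choose R hR using hR
  refine ⟨fun u => R u * B u * (R u)⁻¹, U ∩ S, inter_mem hU (hSo.mem_nhds ht), fun i j => ?_, ?_⟩
  · have habs : ContDiffOn ℝ k (fun u : ℝ => |u|) (U ∩ S) :=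
      contDiffOn_abs_of_ne fun u hu => hS u hu.2
    have hinv : ContDiffOn ℝ k (fun u : ℝ => |u|⁻¹) (U ∩ S) :=
      habs.inv fun u hu => abs_ne_zero.2 (hS u hu.2)
    refine (((contDiffOn_lastDiag hinv i).mul ((hB i j).mono inter_subset_left)).mul
      (contDiffOn_lastDiag habs j)).congr fun u hu => ?_
    obtain ⟨-, h1, h2⟩ := hR u (hS u hu.2)
    rw [Matrix.GeneralLinearGroup.coe_mul, Matrix.GeneralLinearGroup.coe_mul, h1, h2, lastDiag,
      lastDiag, Matrix.mul_diagonal, Matrix.diagonal_mul]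
  · intro u hu
    rw [map_mul, map_mul, map_inv, (hR u (hS u hu.2)).1, hBg u hu.1]

theorem isOpen_times (s ε : ℝ) : IsOpen (times s ε) :=
  (isOpen_lt continuous_const (continuous_const.mul continuous_id)).inter
    (isOpen_lt continuous_abs continuous_const)

theorem ne_zero_of_mem_times {s ε t : ℝ} (ht : t ∈ times s ε) : t ≠ 0 := by
  rintro rfl
  simpa using ht.1

theorem times_mono {s δ ε : ℝ} (h : δ ≤ ε) : times s δ ⊆ times s ε :=
  fun _ ht => ⟨ht.1, ht.2.trans_le h⟩

theorem exists_times_of_eventually {s : ℝ} {P : ℝ → Prop}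
    (h : ∀ᶠ t in 𝓝[{t | 0 < s * t}] 0, P t) : ∃ ε > 0, ∀ t ∈ times s ε, P t := by
  obtain ⟨ε, hε, h'⟩ := Metric.mem_nhdsWithin_iff.1 h
  exact ⟨ε, hε, fun t ht => h' ⟨by simpa using ht.2, ht.1⟩⟩

end Rescaling

/-! ### Weighted sums of translates -/

section WeightedSum

variable {n : ℕ} {Γ N : Type*} [Group Γ] [MulAction Γ N]

/-- The sum of the translates of the function `d`, weighted by the translates of `χ`, where `γ` acts
through the matrix `a γ`. -/
def wsum (S : Finset Γ) (χ : N → ℝ) (d : N → Vec n) (a : Γ → Mat n) (y : N) : Vec n :=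
  ∑ γ ∈ S, a γ *ᵥ (χ (γ⁻¹ • y) • d (γ⁻¹ • y))

/-- Reindex by `γ ↦ α * γ`. A nonzero term has `γ⁻¹ • y ∈ K`, and then `α * γ` carries this point to
`α • y ∈ K`, so it again lies in `S`; only products of elements of `S` are needed. -/
theorem wsum_smul {S : Finset Γ} {χ : N → ℝ} {d : N → Vec n} {a : Γ → Mat n} {K : Set N}
    (hχ : ∀ x, χ x ≠ 0 → x ∈ K) (hS : ∀ γ, γ ∈ S ↔ ∃ u ∈ K, γ • u ∈ K)
    (ha : ∀ β ∈ S, ∀ γ ∈ S, a β * a γ = a (β * γ)) {α : Γ} {y : N} (hy : y ∈ K)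
    (hαy : α • y ∈ K) : wsum S χ d a (α • y) = a α *ᵥ wsum S χ d a y := by
  have hα : α ∈ S := (hS α).2 ⟨y, hy, hαy⟩
  rw [wsum, wsum, Matrix.mulVec_sum]
  have hne : ∀ (γ : Γ) (z : N) (A : Mat n),
      A *ᵥ (χ (γ⁻¹ • z) • d (γ⁻¹ • z)) ≠ 0 → γ⁻¹ • z ∈ K := by
    intro γ z A h
    refine hχ _ fun h0 => h ?_
    rw [h0, zero_smul, Matrix.mulVec_zero]
  symm
  -- `S` need not be closed under multiplication, so only nonzero terms are matched.
  refine Finset.sum_bij_ne_zero (fun γ _ _ => α * γ) ?_ ?_ ?_ ?_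
  · intro γ hγ h
    rw [Matrix.mulVec_mulVec] at h
    refine (hS _).2 ⟨γ⁻¹ • y, hne γ y _ h, ?_⟩
    rwa [mul_smul, smul_inv_smul]
  · intro γ _ _ γ' _ _ h
    exact mul_left_cancel h
  · intro γ hγ h
    have hK := hne γ _ _ h
    have hγ' : α⁻¹ * γ ∈ S := by
      refine (hS _).2 ⟨_, hK, ?_⟩
      rwa [mul_smul, smul_inv_smul, inv_smul_smul]
    refine ⟨α⁻¹ * γ, hγ', ?_, by simp⟩
    rw [Matrix.mulVec_mulVec, ha α hα _ hγ']
    simpa [mul_smul] using h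
  · intro γ hγ _
    rw [Matrix.mulVec_mulVec, ha α hα γ hγ, mul_inv_rev, mul_smul, inv_smul_smul]

/-- By equivariance each translate is a multiple of `affineRep (D y)`, and the total factor can be
read off in the coordinate normalized to 1. -/
theorem wsum_eq_smul [NeZero n] {S : Finset Γ} {χ : N → ℝ} {D : N → RP n} {τ : Γ → PGL n}
    (hX : ∀ x, D x ∈ X n 0) (hD : ∀ γ x, D (γ • x) = τ γ • D x) {a : Γ → Mat n}
    (ha : ∀ γ, IsPosLift (a γ) (τ γ)) (y : N) :
    wsum S χ (fun x => affineRep (D x)) a y =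
      wsum S χ (fun x => affineRep (D x)) a y (i₀ n) • affineRep (D y) := by
  rw [wsum, Finset.sum_apply, Finset.sum_smul]
  refine Finset.sum_congr rfl fun γ _ => ?_
  have h := ((ha γ).mulVec_affineRep (hX (γ⁻¹ • y))).2
  rw [← hD, smul_inv_smul] at h
  rw [Matrix.mulVec_smul, h, Pi.smul_apply, Pi.smul_apply, smul_eq_mul, smul_eq_mul,
    (affineRep_spec (hX y)).1, mul_one, smul_smul]

/-- Future-preserving lifts make all terms nonnegative in this coordinate, so nothing cancels. -/
theorem wsum_coord_pos [NeZero n] {S : Finset Γ} {χ : N → ℝ} {D : N → RP n} {τ : Γ → PGL n}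
    (hX : ∀ x, D x ∈ X n 0) {a : Γ → Mat n} (ha : ∀ γ, IsPosLift (a γ) (τ γ))
    (hχ : ∀ x, 0 ≤ χ x) {y : N} (hy : ∃ γ ∈ S, χ (γ⁻¹ • y) ≠ 0) :
    0 < wsum S χ (fun x => affineRep (D x)) a y (i₀ n) := by
  rw [wsum, Finset.sum_apply]
  have hpos := fun γ => ((ha γ).mulVec_affineRep (hX (γ⁻¹ • y))).1
  obtain ⟨γ, hγ, h⟩ := hy
  refine Finset.sum_pos' (fun γ _ => ?_) ⟨γ, hγ, ?_⟩
  · rw [Matrix.mulVec_smul, Pi.smul_apply]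
    exact mul_nonneg (hχ _) (hpos γ).le
  · rw [Matrix.mulVec_smul, Pi.smul_apply]
    exact mul_pos ((hχ _).lt_of_ne' h) (hpos γ)

theorem continuous_wsum [TopologicalSpace N] {S : Finset Γ} {χ : N → ℝ} {d : N → Vec n}
    (hχ : Continuous χ) (hd : Continuous d) (hsm : ∀ γ : Γ, Continuous fun x : N => γ • x) :
    Continuous fun z : (Γ → Mat n) × N => wsum S χ d z.1 z.2 := by
  unfold wsum
  refine continuous_finsetSum _ fun γ _ => Continuous.matrix_mulVec ?_ ?_
  · exact (continuous_apply γ).comp continuous_fst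
  · have := (hsm γ⁻¹).comp (continuous_snd (X := Γ → Mat n) (Y := N))
    exact (hχ.comp this).smul (hd.comp this)

end WeightedSum

/-! ### Perturbing an equivariant map -/

section Openness

variable {n : ℕ} {E H N Γ : Type*} [NormedAddCommGroup E] [NormedSpace ℝ E]
  [TopologicalSpace H] {I : ModelWithCorners ℝ E H}
  [TopologicalSpace N] [ChartedSpace H N] [Group Γ] [MulAction Γ N]

theorem continuous_toLin'_clm :
    Continuous fun A : Mat n => LinearMap.toContinuousLinearMap (Matrix.toLin' A) := by
  let L : Mat n →ₗ[ℝ] (Vec n →L[ℝ] Vec n) :=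
    LinearMap.toContinuousLinearMap.toLinearMap ∘ₗ Matrix.toLin'.toLinearMap
  exact L.continuous_of_finiteDimensional

theorem contMDiff_wsum {S : Finset Γ} {χ : N → ℝ} {d : N → Vec n}
    (hsm : ∀ γ : Γ, ContMDiff I I ∞ fun x : N => γ • x)
    (hχ : ContMDiff I 𝓘(ℝ, ℝ) ∞ χ) (hd : ContMDiff I 𝓘(ℝ, Vec n) ∞ d) (a : Γ → Mat n) :
    ContMDiff I 𝓘(ℝ, Vec n) ∞ (wsum S χ d a) := by
  refine contMDiff_finsetSum fun γ _ => ?_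
  exact (LinearMap.toContinuousLinearMap (Matrix.toLin' (a γ))).contMDiff.comp
    ((hχ.smul hd).comp (hsm γ⁻¹))

theorem eventually_transverseAt_wsum [FiniteDimensional ℝ E] [IsManifold I ∞ N] {S : Finset Γ} {χ : N → ℝ} {d : N → Vec n}
    (hsm : ∀ γ : Γ, ContMDiff I I ∞ fun x : N => γ • x)
    (hχ : ContMDiff I 𝓘(ℝ, ℝ) ∞ χ) (hd : ContMDiff I 𝓘(ℝ, Vec n) ∞ d) {K : Set N}
    (hK : IsCompact K) {a₀ : Γ → Mat n} (h₀ : ∀ y ∈ K, TransverseAt I (wsum S χ d a₀) y) :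
    ∀ᶠ a in 𝓝 a₀, ∀ y ∈ K, TransverseAt I (wsum S χ d a) y := by
  have : IsManifold I 1 N := .of_le (n := ∞) (by simp)
  refine hK.eventually_forall_of_forall_eventually fun y hy => ?_
  let c : (Γ → Mat n) → Γ → Vec n →L[ℝ] Vec n := fun a γ =>
    LinearMap.toContinuousLinearMap (Matrix.toLin' (a γ))
  have hc : Continuous c := continuous_pi fun γ =>
    continuous_toLin'_clm.comp (continuous_apply γ)
  have key := eventually_transverseAt_sum (I := I) S
    (h := fun (γ : Γ) (y : N) => χ (γ⁻¹ • y) • d (γ⁻¹ • y)) (a₀ := c a₀) (y₀ := y)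
    (fun γ => ((hχ.smul hd).comp (hsm γ⁻¹)).of_le (by simp)) (h₀ y hy)
  have hcc : Tendsto (fun z : (Γ → Mat n) × N => (c z.1, z.2)) (𝓝 (a₀, y)) (𝓝 (c a₀, y)) :=
    (hc.prodMap continuous_id).tendsto (a₀, y)
  exact hcc.eventually key

theorem continuous_dotProduct_eta_mulVec :
    Continuous fun z : ℝ × Vec n => z.2 ⬝ᵥ (eta n z.1 *ᵥ z.2) := by
  simp only [dotProduct_eta_mulVec, sign_mul_sq]
  fun_prop

theorem _root_.IsCompact.eventually_forall_lt_zero {T N : Type*} [TopologicalSpace T]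
    [TopologicalSpace N] {K : Set N} (hK : IsCompact K) {g : T → N → ℝ}
    (hg : Continuous fun z : T × N => g z.1 z.2) {x₀ : T} (h : ∀ y ∈ K, g x₀ y < 0) :
    ∀ᶠ x in 𝓝 x₀, ∀ y ∈ K, g x y < 0 :=
  hK.eventually_forall_of_forall_eventually fun y hy =>
    hg.continuousAt.eventually_lt_const (h y hy)

theorem eventually_eta_wsum_neg {S : Finset Γ} {χ : N → ℝ} {d : N → Vec n}
    (hsm : ∀ γ : Γ, Continuous fun x : N => γ • x)
    (hχ : Continuous χ) (hd : Continuous d) {K : Set N}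
    (hK : IsCompact K) {a₀ : Γ → Mat n}
    (h₀ : ∀ y ∈ K, wsum S χ d a₀ y ⬝ᵥ (eta n 0 *ᵥ wsum S χ d a₀ y) < 0) :
    ∀ᶠ q : ℝ × (Γ → Mat n) in 𝓝 (0, a₀), ∀ y ∈ K,
      wsum S χ d q.2 y ⬝ᵥ (eta n q.1 *ᵥ wsum S χ d q.2 y) < 0 := by
  have hc := continuous_wsum (S := S) hχ hd hsm
  have hw : Continuous fun z : (ℝ × (Γ → Mat n)) × N => wsum S χ d z.1.2 z.2 :=
    hc.comp ((continuous_snd.comp continuous_fst).prodMk continuous_snd)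
  have hη : Continuous fun z : (ℝ × (Γ → Mat n)) × N =>
      wsum S χ d z.1.2 z.2 ⬝ᵥ (eta n z.1.1 *ᵥ wsum S χ d z.1.2 z.2) :=
    continuous_dotProduct_eta_mulVec.comp ((continuous_fst.comp continuous_fst).prodMk hw)
  have h₁ : ∀ y ∈ K, (fun (q : ℝ × (Γ → Mat n)) y => wsum S χ d q.2 y ⬝ᵥ
      (eta n q.1 *ᵥ wsum S χ d q.2 y)) (0, a₀) y < 0 := by
    intro y hy
    dsimp only
    exact h₀ y hy
  exact hK.eventually_forall_lt_zero hη h₁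

end Openness

/-! ### Conditions that hold at all small times -/

section Regeneration

variable {n : ℕ} {E H N Γ : Type*} [NormedAddCommGroup E] [NormedSpace ℝ E]
  [TopologicalSpace H] {I : ModelWithCorners ℝ E H}
  [TopologicalSpace N] [ChartedSpace H N] [Group Γ] [MulAction Γ N]

/-- The representation `r`, conjugated by the rescaling map. -/
def rescRep (r : ℝ → Γ →* PGL n) (t : ℝ) (γ : Γ) : PGL n :=
  resc n t * r t γ * (resc n t)⁻¹

theorem rescRep_mul (r : ℝ → Γ →* PGL n) (t : ℝ) (β γ : Γ) :
    rescRep r t (β * γ) = rescRep r t β * rescRep r t γ := by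
  simp [rescRep, mul_assoc]

/-- The matrices of determinant `±1` near the matrices `a₀ γ` that represent the conjugate by the
rescaling map of the representation `r t`. -/
def liftRep (r : ℝ → Γ →* PGL n) (a₀ : Γ → Mat n) (t : ℝ) (γ : Γ) : Mat n :=
  lift (rescRep r t γ) (a₀ γ)

/-- The time `t` is so small that the perturbed map at time `t` is an immersion into `𝕏_t` over `K`
and the matrices `liftRep r a₀ t γ` multiply as they should. -/
structure IsSmallTime (I : ModelWithCorners ℝ E H) (S : Finset Γ) (K : Set N) (χ : N → ℝ)
    (d : N → Vec n) (r : ℝ → Γ →* PGL n) (a₀ : Γ → Mat n) (t : ℝ) : Prop where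
  transverse : ∀ y ∈ K, TransverseAt I (wsum S χ d (liftRep r a₀ t)) y
  neg : ∀ y ∈ K, wsum S χ d (liftRep r a₀ t) y ⬝ᵥ
    (eta n t *ᵥ wsum S χ d (liftRep r a₀ t) y) < 0
  frob_pos : ∀ γ ∈ S, 0 < frob (liftRep r a₀ t γ) (a₀ γ)
  mul : ∀ β ∈ S, ∀ γ ∈ S, liftRep r a₀ t β * liftRep r a₀ t γ = liftRep r a₀ t (β * γ)

/-- At the limit `a₀` the sum is a positive function times the affine lift, hence an immersion and
negative for `η₀`. Both conditions are open, uniformly on the compact set `K`. -/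
theorem eventually_isSmallTime [NeZero n] [FiniteDimensional ℝ E] [IsManifold I ∞ N]
    (hsm : ∀ γ : Γ, ContMDiff I I ∞ fun x : N => γ • x) {χ : N → ℝ}
    (hχ : ContMDiff I 𝓘(ℝ, ℝ) ∞ χ) (hχ0 : ∀ x, 0 ≤ χ x) {K : Set N} (hK : IsCompact K)
    {S : Finset Γ} (hS : ∀ y ∈ K, ∃ γ ∈ S, χ (γ⁻¹ • y) ≠ 0) {D : N → RP n}
    (hX : ∀ x, D x ∈ X n 0)
    (hd : ContMDiff I 𝓘(ℝ, Vec n) ∞ fun x => affineRep (D x))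
    (hdt : ∀ x, TransverseAt I (fun x => affineRep (D x)) x) {τ : Γ →* PGL n}
    (hD : ∀ γ x, D (γ • x) = τ γ • D x) {a₀ : Γ → Mat n} (ha : ∀ γ, IsPosLift (a₀ γ) (τ γ))
    {r : ℝ → Γ →* PGL n} {l : Filter ℝ} (hl : l ≤ 𝓝 0)
    (hr : ∀ γ, Tendsto (fun t => rescRep r t γ) l (𝓝 (τ γ))) :
    ∀ᶠ t in l, IsSmallTime I S K χ (fun x => affineRep (D x)) r a₀ t := by
  set d : N → Vec n := fun x => affineRep (D x) with hd_def
  have hlim : ∀ γ, Tendsto (fun t => liftRep r a₀ t γ) l (𝓝 (a₀ γ)) := fun γ =>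
    tendsto_lift (hr γ) (ha γ).isLift
  have hlim' : Tendsto (liftRep r a₀) l (𝓝 a₀) := tendsto_pi_nhds.2 hlim
  have hw := wsum_eq_smul (S := S) (χ := χ) hX hD ha
  have hpos : ∀ y ∈ K, 0 < wsum S χ d a₀ y (i₀ n) := fun y hy =>
    wsum_coord_pos hX ha hχ0 (hS y hy)
  have hsmooth := contMDiff_wsum (S := S) hsm hχ hd a₀
  have h1 := eventually_transverseAt_wsum (S := S) hsm hχ hd hK (a₀ := a₀) (by
    intro y hy
    refine TransverseAt.congr ?_ (Eventually.of_forall hw)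
    refine (hdt y).smul (hd.mdifferentiable (by simp) y) ?_ (hpos y hy).ne'
    exact (contMDiff_pi_space.1 hsmooth (i₀ n)).mdifferentiable (by simp) y)
  have h2 := eventually_eta_wsum_neg (S := S) (fun γ => (hsm γ).continuous) hχ.continuous
    hd.continuous hK (a₀ := a₀) (by
      intro y hy
      rw [hw, Matrix.mulVec_smul, smul_dotProduct, dotProduct_smul, smul_eq_mul, smul_eq_mul]
      exact mul_neg_of_pos_of_neg (hpos y hy)
        (mul_neg_of_pos_of_neg (hpos y hy) (affineRep_spec (hX y)).2.2.2))
  have h3 : ∀ γ ∈ S, ∀ᶠ t in l, 0 < frob (liftRep r a₀ t γ) (a₀ γ) := fun γ _ =>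
    (((continuous_frob (a₀ γ)).tendsto _).comp (hlim γ)).eventually
      (lt_mem_nhds (frob_self_pos (ha γ).isLift.ne_zero))
  -- Both sides lift the same element, so they agree up to sign; both converge to `a₀ (β * γ)`,
  -- which fixes the sign for small `t`.
  have h4 : ∀ β ∈ S, ∀ γ ∈ S, ∀ᶠ t in l,
      liftRep r a₀ t β * liftRep r a₀ t γ = liftRep r a₀ t (β * γ) := by
    intro β _ γ _
    have hmul : a₀ (β * γ) = a₀ β * a₀ γ := by
      refine ((ha β).mul (ha γ)).eq ?_
      rw [← map_mul]
      exact ha _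
    have ht : Tendsto (fun t => liftRep r a₀ t β * liftRep r a₀ t γ) l (𝓝 (a₀ (β * γ))) := by
      rw [hmul]
      exact (hlim β).mul (hlim γ)
    filter_upwards [(((continuous_frob (a₀ (β * γ))).tendsto _).comp ht).eventually
      (lt_mem_nhds (frob_self_pos (ha (β * γ)).isLift.ne_zero))] with t ht
    refine IsLift.eq_lift ?_ ht
    rw [rescRep_mul]
    exact (isLift_lift _ _).mul (isLift_lift _ _)
  have hl' : Tendsto (fun t => (t, liftRep r a₀ t)) l (𝓝 (0, a₀)) := by
    rw [nhds_prod_eq]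
    exact Tendsto.prodMk (tendsto_id.mono_right hl) hlim'
  filter_upwards [hlim'.eventually h1, hl'.eventually h2, (Finset.eventually_all S).2 h3,
    (Finset.eventually_all S).2 fun β hβ => (Finset.eventually_all S).2 (h4 β hβ)]
    with t h1 h2 h3 h4
  exact ⟨h1, h2, h3, h4⟩

end Regeneration

/-! ### The regenerated family -/

section Family

variable {n : ℕ} {E H N Γ : Type*} [NormedAddCommGroup E] [NormedSpace ℝ E]
  [TopologicalSpace H] {I : ModelWithCorners ℝ E H}
  [TopologicalSpace N] [ChartedSpace H N] [Group Γ] [MulAction Γ N]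

/-- The map to `𝕏_s` at time `t`: at `x` it is the equivariant extension of the weighted sum, through
the element `b x` of the group for which `(b x)⁻¹ • x` lies in the support of the weight. -/
def family (S : Finset Γ) (χ : N → ℝ) (d : N → Vec n) (r : ℝ → Γ →* PGL n) (a₀ : Γ → Mat n)
    (b : N → Γ) (t : ℝ) (x : N) : RP n :=
  r t (b x) • (resc n t)⁻¹ • toRP (wsum S χ d (liftRep r a₀ t) ((b x)⁻¹ • x))

variable {S : Finset Γ} {K : Set N} {χ : N → ℝ} {d : N → Vec n} {r : ℝ → Γ →* PGL n}
  {a₀ : Γ → Mat n} {b : N → Γ} {t : ℝ}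

/-- Any `β` that brings `x` into `K` may replace `b x`: equivariance of the sum on `K` absorbs the
difference `(b x)⁻¹ * β`. -/
theorem IsSmallTime.family_eq (ht : IsSmallTime I S K χ d r a₀ t)
    (hχ : ∀ x, χ x ≠ 0 → x ∈ K) (hS : ∀ γ, γ ∈ S ↔ ∃ u ∈ K, γ • u ∈ K)
    (hb : ∀ x, χ ((b x)⁻¹ • x) ≠ 0) {β : Γ} {x : N} (hβ : β⁻¹ • x ∈ K) :
    family S χ d r a₀ b t x =
      r t β • (resc n t)⁻¹ • toRP (wsum S χ d (liftRep r a₀ t) (β⁻¹ • x)) := by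
  have hy : ((b x)⁻¹ * β) • β⁻¹ • x = (b x)⁻¹ • x := by rw [mul_smul, smul_inv_smul]
  have hbK := hχ _ (hb x)
  have h := wsum_smul hχ hS ht.mul hβ (α := (b x)⁻¹ * β) (d := d) (by rwa [hy])
  rw [hy] at h
  have hl : IsLift (liftRep r a₀ t ((b x)⁻¹ * β)) (rescRep r t ((b x)⁻¹ * β)) :=
    isLift_lift _ _
  rw [family, h, ← hl.smul_toRP (ne_zero_of_neg (ht.neg _ hβ)), rescRep]
  simp only [smul_smul, map_mul, map_inv]
  congr 1
  group

/-- Use `γ * b x` in place of `b (γ • x)`. -/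
theorem IsSmallTime.family_smul (ht : IsSmallTime I S K χ d r a₀ t)
    (hχ : ∀ x, χ x ≠ 0 → x ∈ K) (hS : ∀ γ, γ ∈ S ↔ ∃ u ∈ K, γ • u ∈ K)
    (hb : ∀ x, χ ((b x)⁻¹ • x) ≠ 0) (γ : Γ) (x : N) :
    family S χ d r a₀ b t (γ • x) = r t γ • family S χ d r a₀ b t x := by
  have hbK := hχ _ (hb x)
  have h : (γ * b x)⁻¹ • γ • x = (b x)⁻¹ • x := by
    rw [mul_inv_rev, mul_smul, inv_smul_smul]
  rw [ht.family_eq hχ hS hb (β := γ * b x) (by rwa [h]), h, map_mul, mul_smul, family]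

theorem IsSmallTime.family_mem_X {s : ℝ} (hs : s = 1 ∨ s = -1) (hst : 0 < s * t)
    (ht : IsSmallTime I S K χ d r a₀ t) (hχ : ∀ x, χ x ≠ 0 → x ∈ K)
    (hb : ∀ x, χ ((b x)⁻¹ • x) ≠ 0) (hr : ∀ γ, r t γ ∈ isom n s) (x : N) :
    family S χ d r a₀ b t x ∈ X n s := by
  have hneg := ht.neg _ (hχ _ (hb x))
  have ht0 : t ≠ 0 := by
    rintro rfl
    simp at hst
  obtain ⟨h1, h2⟩ := resc_inv_smul_toRP ht0 (ne_zero_of_neg hneg)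
  refine isom_smul_mem_X (hr _) ?_
  rw [h1, toRP_mem_X h2, eta_lastDiag_mulVec hs hst]
  exact hneg

theorem mem_nhds_inv_smul_ne_zero (hsm : ∀ γ : Γ, Continuous fun x : N => γ • x)
    (hχ : Continuous χ) {β : Γ} {x : N} (h : χ (β⁻¹ • x) ≠ 0) :
    {y | χ (β⁻¹ • y) ≠ 0} ∈ 𝓝 x :=
  (isOpen_ne.preimage (hχ.comp (hsm β⁻¹))).mem_nhds h

/-- The choice `b` may jump, but near `x` the constant `β = b x` serves. The map then lifts to a
fixed invertible matrix applied to the immersion `w` after a deck transformation. -/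
theorem IsSmallTime.isProjLocalDiffeo_family [FiniteDimensional ℝ E]
    (hE : Module.finrank ℝ E = n) (ht : IsSmallTime I S K χ d r a₀ t)
    (hsm : ∀ γ : Γ, ContMDiff I I ∞ fun x : N => γ • x)
    (hinj : ∀ (γ : Γ) (x : N), Function.Injective (mfderiv I I (fun x : N => γ • x) x))
    (hχs : ContMDiff I 𝓘(ℝ, ℝ) ∞ χ) (hd : ContMDiff I 𝓘(ℝ, Vec n) ∞ d)
    (hχ : ∀ x, χ x ≠ 0 → x ∈ K) (hS : ∀ γ, γ ∈ S ↔ ∃ u ∈ K, γ • u ∈ K)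
    (hb : ∀ x, χ ((b x)⁻¹ • x) ≠ 0) :
    IsProjLocalDiffeo I (family S χ d r a₀ b t) := by
  intro x
  set β := b x
  have hβ : χ (β⁻¹ • x) ≠ 0 := hb x
  obtain ⟨B, hB⟩ := Matrix.ProjGenLinGroup.mk_surjective (r t β * (resc n t)⁻¹)
  let A : Vec n →L[ℝ] Vec n := LinearMap.toContinuousLinearMap (Matrix.toLin' (B : Mat n))
  have hA : ∀ v, A v = (B : Mat n) *ᵥ v := fun v => rfl
  have hAinj : Function.Injective A := (injective_iff_map_eq_zero A).2 fun v hv => by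
    by_contra h
    exact GL_mulVec_ne_zero B h hv
  set w := wsum S χ d (liftRep r a₀ t)
  have hw : ContMDiff I 𝓘(ℝ, Vec n) ∞ w := contMDiff_wsum hsm hχs hd _
  have hwβ : ContMDiff I 𝓘(ℝ, Vec n) ∞ fun y => w (β⁻¹ • y) := hw.comp (hsm β⁻¹)
  have htr : TransverseAt I (fun y => A (w (β⁻¹ • y))) x := by
    refine TransverseAt.clm_comp ?_ (hwβ.mdifferentiable (by simp) x) hAinj
    exact (ht.transverse _ (hχ _ hβ)).comp (hw.mdifferentiable (by simp) _)
      ((hsm β⁻¹).mdifferentiable (by simp) x) (hinj _ _)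
  refine ⟨fun y => A (w (β⁻¹ • y)), {y | χ (β⁻¹ • y) ≠ 0},
    mem_nhds_inv_smul_ne_zero (fun γ => (hsm γ).continuous) hχs.continuous hβ,
    (A.contMDiff.comp hwβ).contMDiffOn, isLiftOn_iff.2 fun y hy => ?_,
    ((transverseAt_iff hE).1 htr).2⟩
  have hyK := hχ _ hy
  have hne : w (β⁻¹ • y) ≠ 0 := ne_zero_of_neg (ht.neg _ hyK)
  refine ⟨GL_mulVec_ne_zero B hne, ?_⟩
  rw [hA, ← mk_smul_toRP B hne, hB, ht.family_eq hχ hS hb hyK, mul_smul]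

theorem projContMDiffOn_family {ε δ s : ℝ}
    (ht : ∀ t ∈ times s ε, IsSmallTime I S K χ d r a₀ t) (hδ : δ ≤ ε)
    (hsm : ∀ γ : Γ, ContMDiff I I ∞ fun x : N => γ • x)
    (hχs : ContMDiff I 𝓘(ℝ, ℝ) ∞ χ) (hd : ContMDiff I 𝓘(ℝ, Vec n) ∞ d)
    (hχ : ∀ x, χ x ≠ 0 → x ∈ K) (hS : ∀ γ, γ ∈ S ↔ ∃ u ∈ K, γ • u ∈ K)
    (hb : ∀ x, χ ((b x)⁻¹ • x) ≠ 0) {k : ℕ∞}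
    (hr : ∀ γ, PathContDiffOn k (fun t => r t γ) (times s δ)) :
    ProjContMDiffOn (𝓘(ℝ, ℝ).prod I) k
      (fun q : ℝ × N => family S χ d r a₀ b q.1 q.2) (times s δ ×ˢ univ) := by
  rintro ⟨t, x⟩ ⟨htδ, -⟩
  have ht0 : ∀ u ∈ times s δ, u ≠ 0 := fun u hu => ne_zero_of_mem_times hu
  have htε : times s δ ⊆ times s ε := times_mono hδ
  set β := b x
  have hβ : χ (β⁻¹ • x) ≠ 0 := hb x
  have hlift : ∀ γ ∈ S, ∃ V ∈ 𝓝 t, ∀ i j, ContDiffOn ℝ k (fun u => liftRep r a₀ u γ i j) V := by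
    intro γ hγ
    obtain ⟨B, U, hU, hB, hBg⟩ := (hr γ).conj_resc ht0 (isOpen_times s δ) t htδ
    exact exists_contDiffOn_lift (g := fun u => rescRep r u γ) hU hB hBg
      ((ht t (htε htδ)).frob_pos γ hγ)
  choose! V hV hVd using hlift
  obtain ⟨B, U, hU, hB, hBg⟩ := hr β t htδ
  -- Near `t` all the finitely many lifts indexed by `S`, and the path `r u β`, have `C^k` matrices;
  -- staying in `times s δ` avoids 0, so `|u|` is smooth.
  let U' : Set ℝ := U ∩ times s δ ∩ ⋂ γ ∈ S, V γ
  have hU' : U' ∈ 𝓝 t := inter_mem (inter_mem hU ((isOpen_times s δ).mem_nhds htδ))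
    ((Filter.biInter_finset_mem S).2 hV)
  refine ⟨fun q => (B q.1 : Mat n) *ᵥ (lastDiag n |q.1| *ᵥ
    wsum S χ d (liftRep r a₀ q.1) (β⁻¹ • q.2)), U' ×ˢ {y | χ (β⁻¹ • y) ≠ 0},
    prod_mem_nhds hU'
      (mem_nhds_inv_smul_ne_zero (fun γ => (hsm γ).continuous) hχs.continuous hβ), ?_, ?_⟩
  · have hfst : ∀ {φ : ℝ → ℝ}, ContDiffOn ℝ k φ U' →
        ContMDiffOn (𝓘(ℝ, ℝ).prod I) 𝓘(ℝ, ℝ) k (fun q : ℝ × N => φ q.1)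
          (U' ×ˢ {y | χ (β⁻¹ • y) ≠ 0}) := fun hφ =>
      hφ.contMDiffOn.comp contMDiffOn_fst fun q hq => hq.1
    have hsnd : ∀ {ψ : N → ℝ}, ContMDiff I 𝓘(ℝ, ℝ) ∞ ψ →
        ContMDiffOn (𝓘(ℝ, ℝ).prod I) 𝓘(ℝ, ℝ) k (fun q : ℝ × N => ψ q.2)
          (U' ×ˢ {y | χ (β⁻¹ • y) ≠ 0}) := fun hψ =>
      ((hψ.of_le (by exact_mod_cast le_top)).comp contMDiff_snd).contMDiffOn
    have habs : ContDiffOn ℝ k (fun u : ℝ => |u|) U' :=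
      contDiffOn_abs_of_ne fun u hu => ht0 u hu.1.2
    refine contMDiffOn_pi_space.2 fun i => ?_
    simp only [lastDiag, Matrix.mulVec, dotProduct, wsum, Finset.sum_apply, Matrix.diagonal_apply,
      ite_mul, zero_mul, Finset.sum_ite_eq, Finset.mem_univ, if_true]
    refine contMDiffOn_finsetSum fun j _ => ContMDiffOn.mul
      (hfst ((hB i j).mono fun u hu => hu.1.1)) ?_
    refine ContMDiffOn.mul (hfst (contDiffOn_lastDiag habs j)) ?_
    refine contMDiffOn_finsetSum fun γ hγ => contMDiffOn_finsetSum fun m _ => ContMDiffOn.mul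
      (hfst ((hVd γ hγ j m).mono fun u hu => mem_iInter₂.1 hu.2 γ hγ)) ?_
    exact hsnd (contMDiff_pi_space.1 (((hχs.smul hd).comp (hsm γ⁻¹)).comp (hsm β⁻¹)) m)
  · refine isLiftOn_iff.2 ?_
    rintro ⟨u, y⟩ ⟨hu, hy⟩
    have hyK := hχ _ hy
    have hu' := ht u (htε hu.1.2)
    obtain ⟨h1, h2⟩ := resc_inv_smul_toRP (ht0 u hu.1.2) (ne_zero_of_neg (hu'.neg _ hyK))
    refine ⟨GL_mulVec_ne_zero _ h2, ?_⟩
    dsimp only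
    rw [← mk_smul_toRP _ h2, ← h1, hBg u hu.1.1, hu'.family_eq hχ hS hb hyK]

end Family

end HalfPipe

end

/-! ### Regeneration of the half-pipe structure -/

theorem proposition3p3 {n : ℕ} [NeZero n]
    -- the compact manifold with boundary `M₀` and its thickening `M`
    {M₀ : Type*} [TopologicalSpace M₀] [T2Space M₀] [CompactSpace M₀]
    [ChartedSpace (EuclideanHalfSpace n) M₀] [IsManifold (𝓡∂ n) ∞ M₀]
    {M : Type*} [TopologicalSpace M] [T2Space M]
    [ChartedSpace (EuclideanSpace ℝ (Fin n)) M] [IsManifold (𝓡 n) ∞ M]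
    (ι : C(M₀, M)) (hι : HalfPipe.IsThickening n ι)
    -- their universal covers
    {N₀ : Type*} [TopologicalSpace N₀]
    [ChartedSpace (EuclideanHalfSpace n) N₀] [IsManifold (𝓡∂ n) ∞ N₀]
    {p₀ : N₀ → M₀} (hp₀ : HalfPipe.IsUniversalCover (𝓡∂ n) p₀)
    {N : Type*} [TopologicalSpace N]
    [ChartedSpace (EuclideanSpace ℝ (Fin n)) N] [IsManifold (𝓡 n) ∞ N]
    {p : N → M} (hp : HalfPipe.IsUniversalCover (𝓡 n) p)
    -- base points
    {x₀ : M₀} {y₀ : N₀} (hy₀ : p₀ y₀ = x₀) {y : N} (hy : p y = ι x₀)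
    -- the half-pipe structure on `M`
    (σ : FundamentalGroup M (ι x₀) →* HalfPipe.GHP n) (D : N → HalfPipe.RP n)
    (hD : HalfPipe.IsDevelopingMap (𝓡 n) (HalfPipe.X n 0) (HalfPipe.GHP n) hp hy σ D)
    -- `s = 1`: hyperbolic geometry, times `t > 0`; `s = -1`: anti de Sitter geometry, times `t < 0`
    (s : ℝ) (hs : s = 1 ∨ s = -1)
    (ρ : ℝ → FundamentalGroup M₀ x₀ →* HalfPipe.isom n s)
    (hρ : HalfPipe.CompatibleToFirstOrder s ρ (σ.comp (FundamentalGroup.map ι x₀))) :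
    ∃ ε > 0, ∃ F : ℝ → N₀ → HalfPipe.RP n,
      (∀ t ∈ HalfPipe.times s ε,
        HalfPipe.IsDevelopingMap (𝓡∂ n) (HalfPipe.X n s) (HalfPipe.isom n s) hp₀ hy₀ (ρ t) (F t)) ∧
      -- the structures form a `C^k` family wherever the representations do
      ∀ (k : ℕ∞) (δ : ℝ), δ ≤ ε →
        (∀ γ, HalfPipe.PathContDiffOn k (fun t => (ρ t γ : HalfPipe.PGL n)) (HalfPipe.times s δ)) →
        HalfPipe.ProjContMDiffOn (𝓘(ℝ, ℝ).prod (𝓡∂ n)) k (fun q : ℝ × N₀ => F q.1 q.2)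
          (HalfPipe.times s δ ×ˢ univ) := by

  have hE : Module.finrank ℝ (EuclideanSpace ℝ (Fin n)) = n := finrank_euclideanSpace_fin
  have := hp₀.simplyConnectedSpace
  have := hp₀.t2Space
  have := ChartedSpace.locallyPathConnectedSpace (EuclideanHalfSpace n) N₀
  have := hp.simplyConnectedSpace
  have := ChartedSpace.locallyPathConnectedSpace (EuclideanSpace ℝ (Fin n)) N
  have hc₀ := hp₀.isCoveringMap.continuous
  have hc := hp.isCoveringMap.continuous
  obtain ⟨χ, hχs, hχ0, hχc, hχb⟩ := hp₀.exists_bump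
  choose b hb using hχb
  have hχK : ∀ x, χ x ≠ 0 → x ∈ tsupport χ := fun x hx => subset_tsupport χ hx
  have hfin := HalfPipe.finite_deck_of_isCompact hp₀.isCoveringMap hχc.isCompact hχc.isCompact
  have hS : ∀ γ, γ ∈ hfin.toFinset ↔ ∃ u ∈ tsupport χ, γ • u ∈ tsupport χ := fun γ =>
    hfin.mem_toFinset
  -- The based lift of the inclusion pulls the half-pipe developing map back to the cover of `M₀`;
  -- it is an immersion because `ι` is one.
  obtain ⟨L, ⟨hLy, hLp⟩, -⟩ := hp.isCoveringMap.existsUnique_continuousMap_lifts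
    (ι.comp ⟨p₀, hc₀⟩) y₀ y (by simp [hy, hy₀])
  have hLp' : ∀ x, p (L x) = ι (p₀ x) := congrFun hLp
  have hp₀s := hp₀.isLocalDiffeomorph.contMDiff
  have hLs : ContMDiff (𝓡∂ n) (𝓡 n) ∞ L := by
    refine HalfPipe.contMDiff_of_comp_isLocalDiffeomorph hp.isLocalDiffeomorph L.continuous ?_
    rw [hLp]
    exact hι.contMDiff.comp hp₀s
  have hLinj : ∀ x, Function.Injective (mfderiv (𝓡∂ n) (𝓡 n) L x) := by
    intro x
    refine HalfPipe.injective_mfderiv_of_comp (p := p)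
      (hp.isLocalDiffeomorph.mdifferentiable (by simp) _) (hLs.mdifferentiable (by simp) x) ?_
    rw [hLp]
    change Function.Injective (mfderiv (𝓡∂ n) (𝓡 n) (ι ∘ p₀) x)
    rw [mfderiv_comp x (hι.contMDiff.mdifferentiable (by simp) _)
      (hp₀s.mdifferentiable (by simp) x)]
    exact (hι.bijective_mfderiv _).injective.comp
      (hp₀.isLocalDiffeomorph.mfderivToContinuousLinearEquiv (by simp) x).injective
  have hXN : ∀ x, D x ∈ HalfPipe.X n 0 := hD.mem
  have haff := HalfPipe.contMDiffAt_and_transverseAt_affineRep hE hD.isLocalDiffeo hXN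
  have hds : ContMDiff (𝓡∂ n) 𝓘(ℝ, HalfPipe.Vec n) ∞ fun x => HalfPipe.affineRep (D (L x)) :=
    fun x => (haff (L x)).1.comp x (hLs x)
  have hdt : ∀ x, HalfPipe.TransverseAt (𝓡∂ n) (fun x => HalfPipe.affineRep (D (L x))) x :=
    fun x => (haff (L x)).2.comp ((haff (L x)).1.mdifferentiableAt (by simp))
      (hLs.mdifferentiable (by simp) x) (hLinj x)
  let Θ := HalfPipe.deckHom hc₀ hy₀
  let τ : HalfPipe.deck p₀ →* HalfPipe.PGL n :=
    (HalfPipe.GHP n).subtype.comp ((σ.comp (FundamentalGroup.map ι x₀)).comp Θ)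
  let r : ℝ → HalfPipe.deck p₀ →* HalfPipe.PGL n := fun t =>
    (HalfPipe.isom n s).subtype.comp ((ρ t).comp Θ)
  have hDτ : ∀ γ x, D (L (γ • x)) = τ γ • D (L x) := by
    intro γ x
    have hfib : p (L (γ • y₀)) = p y := by rw [hLp', HalfPipe.proj_deck_smul (p := p₀), hy₀, hy]
    -- The deck transformation of `N` corresponding to `γ` is found from the base point; uniqueness
    -- of lifts then gives the intertwining everywhere.
    obtain ⟨γ', hγ'⟩ := HalfPipe.exists_deck_smul_eq hp.isCoveringMap hfib.symm
    have hint : ∀ z, L (γ • z) = γ' • L z := by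
      intro z
      have := hp.isCoveringMap.eq_of_comp_eq
        (L.continuous.comp (HalfPipe.continuous_deck_smul γ))
        ((HalfPipe.continuous_deck_smul γ').comp L.continuous)
        (funext fun w => by
          simp only [Function.comp_apply]
          rw [HalfPipe.proj_deck_smul (p := p), hLp', hLp', HalfPipe.proj_deck_smul (p := p₀)])
        y₀ (by simp only [Function.comp_apply]; rw [hLy, hγ'])
      exact congrFun this z
    obtain ⟨c', hc'⟩ := HalfPipe.map_deckClass hc₀ hc ι L.continuous hLp' hy₀ hy hLy γ γ' hint
      (PathConnectedSpace.somePath _ _)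
    have heq := hD.equivariant γ' γ'.2 c' (L x)
    rw [hint]
    change D ((γ' : N ≃ₜ N) (L x)) = _
    rw [heq, ← hc']
    rfl
  choose a₀ ha₀ using fun γ => HalfPipe.exists_isPosLift (n := n) (g := τ γ)
    (σ (FundamentalGroup.map ι x₀ (Θ γ))).2
  have hsm := hp₀.contMDiff_smul
  have hcover : ∀ y ∈ tsupport χ, ∃ γ ∈ hfin.toFinset, χ (γ⁻¹ • y) ≠ 0 := fun y hy =>
    -- `b y` lies in the finite set since it carries `(b y)⁻¹ • y`, a point of the support, back to
    -- `y`.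
    ⟨b y, (hS _).2 ⟨_, hχK _ (hb y), by rwa [smul_inv_smul]⟩, hb y⟩
  have hsmall := HalfPipe.eventually_isSmallTime hsm hχs hχ0 hχc.isCompact hcover
    (fun x => hXN (L x)) hds hdt hDτ ha₀ (r := r) (l := 𝓝[{t | 0 < s * t}] 0) nhdsWithin_le_nhds
    fun γ => hρ (Θ γ)
  obtain ⟨ε, hε, hεs⟩ := HalfPipe.exists_times_of_eventually hsmall
  refine ⟨ε, hε, HalfPipe.family hfin.toFinset χ (fun x => HalfPipe.affineRep (D (L x))) r a₀ b,
    fun t ht => ⟨fun x => ?_, ?_, fun φ hφ c x => ?_⟩, fun k δ hδ hk => ?_⟩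
  · exact (hεs t ht).family_mem_X hs ht.1 hχK hb (fun γ => (ρ t (Θ γ)).2) x
  · exact (hεs t ht).isProjLocalDiffeo_family hE hsm hp₀.injective_mfderiv_smul hχs hds hχK hS hb
  · rw [← HalfPipe.deckHom_eq hc₀ hy₀ ⟨φ, hφ⟩ c]
    exact (hεs t ht).family_smul hχK hS hb ⟨φ, hφ⟩ x
  · exact HalfPipe.projContMDiffOn_family hεs hδ hsm hχs hds hχK hS hb fun γ => hk (Θ γ)
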